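/- Consider the one-dimensional wave equation $u_{tt}-u_{xx}=0$ on $(0,\pi)\times(0,\infty)$ with $u(0,t)=u(\pi,t)=0$ and initial data $u(\cdot,0)=u_0\in H^1_0(0,\pi)$, $u_t(\cdot,0)=u_1\in L^2(0,\pi)$, let $u\in C([0,\infty);H^1_0(0,\pi))\cap C^1([0,\infty);L^2(0,\pi))$ be its weak solution, and let $E_0=\frac12\int_0^\pi(|u_0'|^2+|u_1|^2)\,dx$. The boundary traces $u_x(0,\cdot),u_x(\pi,\cdot)\in L^2(0,T)$ are understood in the sense of hidden regularity, that is, as the extension by continuity to $H^1_0(0,\pi)\times L^2(0,\pi)$ of the classical traces of the strong solutions, whose data lie in $(H^2\cap H^1_0)(0,\pi)\times H^1_0(0,\pi)$. Let $T_0>0$ and, for $k\in\mathbb N_0=\{0,1,2,\dots\}$, let $I_k=(kT_0,(k+1)T_0)$ and $\lambda_k=0$ if $k$ is even, $\lambda_k=\pi$ if $k$ is odd; put $\mathcal F=\{\{\lambda_k\}\times I_k : k\in\mathbb N_0\}$. The system is called $\mathcal F$-observable in time $T>0$ if there are $n\in\mathbb N_0$ and $c>0$, independent of $(u_0,u_1)$,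 such that $$\sum_{k=0}^n\int_{I_k\cap(0,T)}|u_x(\lambda_k,t)|^2\,dt\ \ge\ c\,E_0\qquad\text{for all }(u_0,u_1)\in H^1_0(0,\pi)\times L^2(0,\pi).$$ It is called $\mathcal F$-observable if it is $\mathcal F$-observable in some time $T>0$. If it is $\mathcal F$-observable in time $T$ but not in any time $T'<T$, then $T_{opt}:=T$ is called the optimal control time. **Lemma.** Suppose that $T_0\in(0,\pi)$ and $2\pi/T_0\notin\mathbb N$, and let $N=\lfloor 2\pi/T_0\rfloor$ and $j=\lfloor \pi/T_0\rfloor$. Then the system is $\mathcal F$-observable. Furthermore: i) if $N$ and $j$ are even, then $T_{opt}=2\pi+jT_0$; ii) if $N$ is even and $j$ is odd, let $h^*=\Big\lceil\dfrac{\pi-jT_0+T_0}{2\pi-NT_0}\Big\rceil$ and $k^*=\Big\lceil\dfrac{T_0}{2\pi-NT_0}\Big\rceil$; if $h^*=k^*+1$, then $T_{opt}=\pi+T_0(Nk^*+1)$, and if $h^*=k^*$, then $T_{opt}=\pi+T_0(Nk^*-j+1)$; iii) if $N$ is odd and $j$ is even, let $l^*=\Big\lceil\dfrac{T_0}{(N+1)T_0-2\pi}\Big\rceil$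 and $q^*=\Big\lceil\dfrac{\pi-jT_0}{(N+1)T_0-2\pi}\Big\rceil$; if $l^*=q^*$, then $T_{opt}=2\pi q^*+jT_0$, and if $l^*=q^*+1$, then $T_{opt}=2\pi q^*+jT_0+\pi$; iv) if $N$ and $j$ are odd, then $T_{opt}=NT_0+\pi$. -/

import Mathlib

open MeasureTheory Set Filter Topology
open scoped Real ContDiff

noncomputable section

namespace AlternatingWave

/-- Lebesgue measure on the space domain `(0, π)`. -/
abbrev spaceMeasure : Measure ℝ := volume.restrict (Ioo (0 : ℝ) π)

/-- The real Hilbert space `L²(0, π)`. -/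
abbrev L2 : Type := Lp ℝ 2 spaceMeasure

/-- `φ` is (the extension by zero of) an element of `C_c^∞(0, π)`. -/
structure IsTestFunction (φ : ℝ → ℝ) : Prop where
  smooth : ContDiff ℝ ∞ φ
  compact : HasCompactSupport φ
  support_subset : tsupport φ ⊆ Ioo (0 : ℝ) π

/-- The pairs `(φ, φ')` with `φ ∈ C_c^∞(0, π)`, as a subspace of `L² × L²`. -/
def testPairs : Submodule ℝ (L2 × L2) where
  carrier := {p | ∃ φ : ℝ → ℝ, IsTestFunction φ ∧
    p.1 =ᵐ[spaceMeasure] φ ∧ p.2 =ᵐ[spaceMeasure] deriv φ}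
  zero_mem' := by
    refine ⟨fun _ => 0, ⟨contDiff_const, HasCompactSupport.zero, by simp [tsupport]⟩, ?_, ?_⟩
    · exact Lp.coeFn_zero _ _ _
    · simpa [Pi.zero_def] using Lp.coeFn_zero ℝ 2 spaceMeasure
  add_mem' := by
    rintro p q ⟨φ, hφ, h1, h2⟩ ⟨ψ, hψ, h3, h4⟩
    refine ⟨φ + ψ, ⟨hφ.smooth.add hψ.smooth, hφ.compact.add hψ.compact,
      (tsupport_add φ ψ).trans (union_subset hφ.support_subset hψ.support_subset)⟩, ?_, ?_⟩
    · exact (Lp.coeFn_add p.1 q.1).trans (h1.add h3)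
    · have hd : deriv (φ + ψ) = deriv φ + deriv ψ := by
        funext x
        exact deriv_add (hφ.smooth.differentiable (by simp) x)
          (hψ.smooth.differentiable (by simp) x)
      rw [hd]
      exact (Lp.coeFn_add p.2 q.2).trans (h2.add h4)
  smul_mem' := by
    rintro c p ⟨φ, hφ, h1, h2⟩
    refine ⟨c • φ, ⟨contDiff_const.smul hφ.smooth, hφ.compact.smul_left (f := fun _ => c),
      (closure_mono (Function.support_const_smul_subset c φ)).trans hφ.support_subset⟩, ?_, ?_⟩
    · exact (Lp.coeFn_smul c p.1).trans (h1.const_smul c)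
    · have hd : deriv (c • φ) = c • deriv φ := by
        funext x
        exact deriv_const_smul c (hφ.smooth.differentiable (by simp) x)
      rw [hd]
      exact (Lp.coeFn_smul c p.2).trans (h2.const_smul c)

/-- `H^1_0(0, π)`, the closure of `C_c^∞(0, π)` in the `H^1` norm.  An element `w` is the pair
`(w, w_x)` of an `L²` function and its weak derivative; the second entry is determined by the
first, and the norm inherited from `L² × L²` is equivalent to the `H^1` norm. -/
abbrev H10 : Type := (testPairs.topologicalClosure : Submodule ℝ (L2 × L2))

/-- The underlying `L²` function of an element of `H^1_0(0, π)`. -/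
def H10.fn (w : H10) : L2 := (w : L2 × L2).1

/-- The weak derivative of an element of `H^1_0(0, π)`. -/
def H10.dx (w : H10) : L2 := (w : L2 × L2).2

/-- `g ∈ L²(0, π)` is the weak derivative of `f ∈ L²(0, π)`. -/
def HasWeakDeriv (f g : L2) : Prop :=
  ∀ φ : ℝ → ℝ, IsTestFunction φ →
    ∫ x in Ioo (0 : ℝ) π, f x * deriv φ x = - ∫ x in Ioo (0 : ℝ) π, g x * φ x

/-- `u` is the weak solution of `u_tt - u_xx = 0` on `(0, π) × (0, ∞)` with homogeneous Dirichlet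
boundary conditions and initial data `u₀ ∈ H^1_0`, `u₁ ∈ L²`, in the class
`C([0,∞); H^1_0) ∩ C^1([0,∞); L²)`, and `v = u_t`.  Values at negative times play no role. -/
structure IsWeakSolution (u₀ : H10) (u₁ : L2) (u : ℝ → H10) (v : ℝ → L2) : Prop where
  continuousOn : ContinuousOn u (Ici 0)
  hasDeriv : ∀ t ∈ Ici (0 : ℝ), HasDerivWithinAt (fun s => (u s).fn) (v t) (Ici 0) t
  continuousOn_deriv : ContinuousOn v (Ici 0)
  /-- `d/dt ⟨u_t, w⟩ + ⟨u_x, w_x⟩ = 0` for all `w ∈ H^1_0`. -/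
  equation : ∀ w : H10, ∀ t ∈ Ici (0 : ℝ),
    HasDerivWithinAt (fun s => inner ℝ (v s) w.fn) (- inner ℝ (u t).dx w.dx) (Ici 0) t
  initial_fn : u 0 = u₀
  initial_deriv : v 0 = u₁

/-- `u` is the strong solution with initial data `u₀ ∈ H² ∩ H^1_0`, `u₁ ∈ H^1_0`, in the class
`C([0,∞); H² ∩ H^1_0) ∩ C²([0,∞); L²)`.  The function `a` is at once `u_tt` and `u_xx`. -/
structure IsStrongSolution (u₀ : H10) (u₁ : L2) (u : ℝ → H10) (v : ℝ → L2) : Prop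
    extends IsWeakSolution u₀ u₁ u v where
  data_fn : ∃ f : L2, HasWeakDeriv u₀.dx f
  data_deriv : ∃ w : H10, w.fn = u₁
  regular : ∃ a : ℝ → L2, ContinuousOn a (Ici 0) ∧
    (∀ t ∈ Ici (0 : ℝ), HasDerivWithinAt v (a t) (Ici 0) t) ∧
    (∀ t ∈ Ici (0 : ℝ), HasWeakDeriv (u t).dx (a t))

/-- The trace at `x ∈ [0, π]` of a function `f ∈ H^1(0, π)`, i.e. the value at `x` of its
representative that is continuous on `[0, π]`, is `b`. -/
def HasTraceAt (f : L2) (x b : ℝ) : Prop :=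
  ∃ F : ℝ → ℝ, ContinuousOn F (Icc 0 π) ∧ f =ᵐ[spaceMeasure] F ∧ F x = b

/-- `g x t` is the classical (Sobolev) trace `u_x(x, t)` at the boundary points `x = 0, π`. -/
def IsClassicalTrace (u : ℝ → H10) (g : ℝ → ℝ → ℝ) : Prop :=
  ∀ t ∈ Ici (0 : ℝ), ∀ x ∈ ({0, π} : Set ℝ), HasTraceAt (u t).dx x (g x t)

/-- `g x t` (`x = 0, π`, `0 < t < T`) is the boundary trace `u_x(x, t)` of the weak solution with
initial data `(u₀, u₁) ∈ H^1_0 × L²`, in the sense of hidden regularity: the value at `(u₀, u₁)`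
of the extension by continuity, from strong data to `H^1_0 × L²` and with values in
`L²({0, π} × (0, T))`, of the map sending strong data to the classical trace. -/
def IsBoundaryTrace (u₀ : H10) (u₁ : L2) (T : ℝ) (g : ℝ → ℝ → ℝ) : Prop :=
  (∀ x ∈ ({0, π} : Set ℝ), MemLp (g x) 2 (volume.restrict (Ioo 0 T))) ∧
  ∃ (a₀ : ℕ → H10) (a₁ : ℕ → L2) (u : ℕ → ℝ → H10) (v : ℕ → ℝ → L2) (G : ℕ → ℝ → ℝ → ℝ),
    (∀ m, IsStrongSolution (a₀ m) (a₁ m) (u m) (v m)) ∧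
    (∀ m, IsClassicalTrace (u m) (G m)) ∧
    Tendsto a₀ atTop (𝓝 u₀) ∧ Tendsto a₁ atTop (𝓝 u₁) ∧
    ∀ x ∈ ({0, π} : Set ℝ), Tendsto
      (fun m => eLpNorm (fun t => G m x t - g x t) 2 (volume.restrict (Ioo 0 T))) atTop (𝓝 0)

/-- The energy `E₀` of the initial data. -/
def energy (u₀ : H10) (u₁ : L2) : ℝ := (1 / 2) * (‖u₀.dx‖ ^ 2 + ‖u₁‖ ^ 2)

/-- The endpoint `λ_k` observed during the `k`-th time interval. -/
def endpoint (k : ℕ) : ℝ := if Even k then 0 else π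

/-- `𝓕`-observability in time `T > 0` for `𝓕 = {{λ_k} × I_k : k ∈ ℕ}`. -/
def ObservableInTime (I : ℕ → Set ℝ) (T : ℝ) : Prop :=
  0 < T ∧ ∃ n : ℕ, ∃ c : ℝ, 0 < c ∧
    ∀ (u₀ : H10) (u₁ : L2) (u : ℝ → H10) (v : ℝ → L2), IsWeakSolution u₀ u₁ u v →
      ∀ g : ℝ → ℝ → ℝ, IsBoundaryTrace u₀ u₁ T g →
        c * energy u₀ u₁ ≤
          ∑ k ∈ Finset.range (n + 1), ∫ t in I k ∩ Ioo 0 T, |g (endpoint k) t| ^ 2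

/-- `𝓕`-observability. -/
def Observable (I : ℕ → Set ℝ) : Prop := ∃ T : ℝ, ObservableInTime I T

/-- `T` is the optimal control time `T_opt`. -/
def IsOptimalTime (I : ℕ → Set ℝ) (T : ℝ) : Prop :=
  ObservableInTime I T ∧ ∀ T' : ℝ, T' < T → ¬ ObservableInTime I T'

/-- Exchange at a constant rate: `I_k = (k T₀, (k + 1) T₀)`. -/
def constantRate (T₀ : ℝ) (k : ℕ) : Set ℝ := Ioo (k * T₀) ((k + 1) * T₀)

end AlternatingWave

end

/-!
By d'Alembert's formula a solution is `u(x, t) = f (t + x) - f (t - x)` with `F = f'` periodic of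
period `2π`, so that `u_x(0, t) = 2 F(t)`, `u_x(π, t) = 2 F(t + π)`, and the energy is the integral
of `F²` over one period.  Observing the endpoint `λ_k` during `I_k` therefore amounts to seeing `F²`
on the translate `I_k + λ_k` of the circle `ℝ / 2πℤ`, and the system is observable in time `T` if
and only if the translates of the sets `I_k ∩ (0, T)` cover the circle up to a null set.

Analytically, weak solutions enter only through the strong solutions approximating the trace.  For
a strong solution, `IsStrongSolution.conserved` tests the equation against smooth standing waves and
shows that the Riemann invariant `F` is transported; letting the test profiles tend to indicators of
arcs centred at a boundary point gives averages of `u_x` over boundary layers, and Lebesgue's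
differentiation theorem identifies the classical traces (`IsStrongSolution.trace_eq`).  A covering
then yields `4 E₀ ≤ ∑ ∫ |u_x|²` for strong solutions, and a weaker constant in the limit
(`observableInTime_of_cover`).  Conversely, if an open arc is missed, a smooth profile `f` varying
only on that arc gives an unobserved solution of positive energy (`not_observableInTime`).

The covering is decided along the times `s + i π`, `s ∈ (0, π)`: each of them observes `s` or
`s + π`, according to the parity of `i + ⌊(s + i π) / T₀⌋`, so that `s` is settled by the time
`s + (i + 1) π` for the first `i` at which `⌊(s + (i + 1) π) / T₀⌋ - ⌊(s + i π) / T₀⌋` is even.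
Write `π / T₀ = j + α` with `0 < α < 1`.  That difference is `j + 1` when the rotation by `α` wraps
around and `j` otherwise.  For odd `j` one waits for the rotation by `α` to wrap, at most
`M = ⌈1 / α⌉` steps, and the worst `s` gives the optimal time `π + T₀ (j M + 1)`
(`isOptimalTime_of_odd`); for even `j` one waits for a step that does not wrap, which is a wrap of
the rotation by `-(1 - α)`, at most `L = ⌈1 / (1 - α)⌉` steps, and the worst `s` gives
`j T₀ + L π` (`isOptimalTime_of_even`).  The parity of `N` says whether `α < 1 / 2`, and the
comparisons of `h` with `k` and of `l` with `q` determine the parity of `M` and of `L`.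
-/

noncomputable section

namespace AlternatingWave

/-! ### Continuous functions as elements of `L²(0, π)` -/

lemma memLp_of_continuous {f : ℝ → ℝ} (hf : Continuous f) : MemLp f 2 spaceMeasure := by
  obtain ⟨C, hC⟩ := (isCompact_Icc (a := (0 : ℝ)) (b := π)).exists_bound_of_continuousOn
    hf.continuousOn
  refine MemLp.of_bound hf.aestronglyMeasurable C ?_
  filter_upwards [ae_restrict_mem measurableSet_Ioo] with x hx
  exact hC x (Ioo_subset_Icc_self hx)

/-- The class in `L²(0, π)` of a continuous function on the line. -/
def contL2 (f : ℝ → ℝ) (hf : Continuous f) : L2 := (memLp_of_continuous hf).toLp f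

lemma coeFn_contL2 {f : ℝ → ℝ} (hf : Continuous f) : contL2 f hf =ᵐ[spaceMeasure] f :=
  MemLp.coeFn_toLp _

lemma inner_contL2 (g : L2) {f : ℝ → ℝ} (hf : Continuous f) :
    inner ℝ g (contL2 f hf) = ∫ x in Ioo 0 π, g x * f x := by
  rw [L2.inner_def]
  refine integral_congr_ae ?_
  filter_upwards [coeFn_contL2 hf] with x hx
  simp [hx, mul_comm]

lemma contL2_add {f g : ℝ → ℝ} (hf : Continuous f) (hg : Continuous g) :
    contL2 f hf + contL2 g hg = contL2 (fun x => f x + g x) (hf.add hg) := rfl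

lemma contL2_sub {f g : ℝ → ℝ} (hf : Continuous f) (hg : Continuous g) :
    contL2 f hf - contL2 g hg = contL2 (fun x => f x - g x) (hf.sub hg) := rfl

lemma contL2_smul {f : ℝ → ℝ} (c : ℝ) (hf : Continuous f) :
    c • contL2 f hf = contL2 (fun x => c * f x) (hf.const_smul c) := rfl

/-- The norm of the constant function `1` in `L²(0, π)`. -/
def oneNorm : ℝ := (measureUnivNNReal spaceMeasure : ℝ) ^ (2 : ENNReal).toReal⁻¹

lemma oneNorm_nonneg : 0 ≤ oneNorm := by unfold oneNorm; positivity

lemma norm_contL2_le {f : ℝ → ℝ} (hf : Continuous f) {C : ℝ} (hC : 0 ≤ C)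
    (h : ∀ x ∈ Ioo 0 π, |f x| ≤ C) : ‖contL2 f hf‖ ≤ oneNorm * C := by
  refine Lp.norm_le_of_ae_bound hC ?_
  filter_upwards [coeFn_contL2 hf, ae_restrict_mem measurableSet_Ioo] with x hx hx'
  rw [hx]
  exact h x hx'

lemma norm_toLp_le {f : ℝ → ℝ} (hf : MemLp f 2 spaceMeasure) {C : ℝ} (hC : 0 ≤ C)
    (h : ∀ x, |f x| ≤ C) : ‖hf.toLp f‖ ≤ oneNorm * C := by
  refine Lp.norm_le_of_ae_bound hC ?_
  filter_upwards [hf.coeFn_toLp] with x hx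
  rw [hx]
  exact h x

/-- The Cauchy–Schwarz inequality against the indicator of `(0, x)`. -/
lemma abs_integral_le_norm {f : ℝ → ℝ} (hf : Continuous f) {x : ℝ} (h0 : 0 ≤ x) (hx : x ≤ π) :
    |∫ y in (0 : ℝ)..x, f y| ≤ oneNorm * ‖contL2 f hf‖ := by
  have hm : MemLp ((Ioo 0 x).indicator fun _ => (1 : ℝ)) 2 spaceMeasure :=
    (memLp_const 1).indicator measurableSet_Ioo
  have h1 : ∫ y in (0 : ℝ)..x, f y = inner ℝ (contL2 f hf) (hm.toLp _) := by
    rw [L2.inner_def, intervalIntegral.integral_of_le h0, integral_Ioc_eq_integral_Ioo]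
    have : (∫ y in Ioo 0 π, (Ioo 0 x).indicator f y) = ∫ y in Ioo 0 x, f y := by
      rw [setIntegral_indicator measurableSet_Ioo]
      congr 2
      rw [inter_eq_right]
      exact Ioo_subset_Ioo_right hx
    rw [← this]
    refine integral_congr_ae ?_
    filter_upwards [coeFn_contL2 hf, hm.coeFn_toLp] with y h1 h2
    rw [h1, h2]
    by_cases hy : y ∈ Ioo 0 x <;> simp [hy]
  rw [h1, mul_comm]
  refine (abs_real_inner_le_norm _ _).trans ?_
  gcongr
  have := norm_toLp_le hm zero_le_one (by
    intro y
    by_cases hy : y ∈ Ioo 0 x <;> simp [hy])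
  simpa using this

/-! ### Elements of `H^1_0(0, π)` -/

lemma IsTestFunction.continuous {φ : ℝ → ℝ} (h : IsTestFunction φ) : Continuous φ :=
  h.smooth.continuous

lemma IsTestFunction.continuous_deriv {φ : ℝ → ℝ} (h : IsTestFunction φ) :
    Continuous (deriv φ) := h.smooth.continuous_deriv (by simp)

lemma IsTestFunction.mem_testPairs {φ : ℝ → ℝ} (h : IsTestFunction φ) :
    (contL2 φ h.continuous, contL2 (deriv φ) h.continuous_deriv) ∈ testPairs :=
  ⟨φ, h, coeFn_contL2 h.continuous, coeFn_contL2 h.continuous_deriv⟩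

/-- Test functions are dense in `L²(0, π)`. -/
lemma exists_testFunction_near (f : L2) {ε : ℝ} (hε : 0 < ε) :
    ∃ (φ : ℝ → ℝ) (h : IsTestFunction φ), ‖contL2 φ h.continuous - f‖ < ε := by
  have htop : (testPairs.map (LinearMap.fst ℝ L2 L2)).topologicalClosure = ⊤ := by
    rw [Submodule.topologicalClosure_eq_top_iff, Submodule.eq_bot_iff]
    intro g hg
    rw [Submodule.mem_orthogonal] at hg
    have hint : IntegrableOn g (Ioo 0 π) volume :=
      (Lp.memLp g).integrable (by norm_num)
    have := IsOpen.ae_eq_zero_of_integral_contDiff_smul_eq_zero (μ := volume)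
      (isOpen_Ioo (a := (0 : ℝ)) (b := π)) hint.locallyIntegrableOn (by
        intro φ h1 h2 h3
        have hφ : IsTestFunction φ := ⟨h1, h2, h3⟩
        have h0 := hg (contL2 φ hφ.continuous) ⟨_, hφ.mem_testPairs, rfl⟩
        rw [real_inner_comm, inner_contL2] at h0
        rw [← h0, ← setIntegral_eq_integral_of_forall_compl_eq_zero (s := Ioo 0 π)]
        · simp [mul_comm]
        · intro x hx
          rw [image_eq_zero_of_notMem_tsupport (fun h => hx (h3 h)), zero_smul])
    rw [Lp.eq_zero_iff_ae_eq_zero]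
    exact (ae_restrict_iff' measurableSet_Ioo).2 this
  have hf : f ∈ closure ((testPairs.map (LinearMap.fst ℝ L2 L2) : Submodule ℝ L2) : Set L2) := by
    rw [← Submodule.topologicalClosure_coe, htop]; trivial
  obtain ⟨_, ⟨p, ⟨φ, hφ, h1, -⟩, rfl⟩, hd⟩ := Metric.mem_closure_iff.1 hf ε hε
  refine ⟨φ, hφ, ?_⟩
  have : contL2 φ hφ.continuous = p.1 := by
    rw [Lp.ext_iff]
    exact (coeFn_contL2 _).trans h1.symm
  rw [this, ← dist_eq_norm, dist_comm]
  exact hd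

lemma IsTestFunction.exists_tsupport_subset_Icc {φ : ℝ → ℝ} (h : IsTestFunction φ) :
    ∃ a b, 0 < a ∧ a ≤ b ∧ b < π ∧ tsupport φ ⊆ Icc a b := by
  have hK : IsCompact (insert (π / 2) (tsupport φ)) := h.compact.isCompact.insert _
  have hsub : insert (π / 2) (tsupport φ) ⊆ Ioo 0 π := by
    rw [insert_subset_iff]
    exact ⟨⟨by positivity, by linarith [Real.pi_pos]⟩, h.support_subset⟩
  obtain ⟨a, ha, hla⟩ := hK.exists_isLeast (insert_nonempty _ _)
  obtain ⟨b, hb, hub⟩ := hK.exists_isGreatest (insert_nonempty _ _)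
  exact ⟨a, b, (hsub ha).1, hla hb, (hsub hb).2,
    fun x hx => ⟨hla (mem_insert_of_mem _ hx), hub (mem_insert_of_mem _ hx)⟩⟩

lemma IsTestFunction.sub_smul {φ ψ : ℝ → ℝ} (h : IsTestFunction φ) (h' : IsTestFunction ψ)
    (c : ℝ) : IsTestFunction (fun x => φ x - c * ψ x) := by
  obtain ⟨a, b, ha, hab, hb, hs⟩ := h.exists_tsupport_subset_Icc
  obtain ⟨a', b', ha', hab', hb', hs'⟩ := h'.exists_tsupport_subset_Icc
  have hsub : tsupport (fun x => φ x - c * ψ x) ⊆ tsupport φ ∪ tsupport ψ := by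
    refine closure_minimal ?_ ((isClosed_tsupport φ).union (isClosed_tsupport ψ))
    intro x hx
    by_contra hn
    rw [mem_union, not_or] at hn
    simp [image_eq_zero_of_notMem_tsupport hn.1, image_eq_zero_of_notMem_tsupport hn.2] at hx
  refine ⟨h.smooth.sub (contDiff_const.mul h'.smooth), ?_, hsub.trans (union_subset
    h.support_subset h'.support_subset)⟩
  exact (h.compact.isCompact.union h'.compact.isCompact).of_isClosed_subset
    (isClosed_tsupport _) hsub

/-- A test function of mean zero has a primitive that is a test function. -/
lemma IsTestFunction.primitive {g : ℝ → ℝ} (h : IsTestFunction g)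
    (h0 : ∫ x in (0 : ℝ)..π, g x = 0) :
    IsTestFunction (fun x => ∫ y in (0 : ℝ)..x, g y) ∧
      deriv (fun x => ∫ y in (0 : ℝ)..x, g y) = g := by
  obtain ⟨a, b, ha, hab, hb, hs⟩ := h.exists_tsupport_subset_Icc
  have hder : ∀ x, HasDerivAt (fun x => ∫ y in (0 : ℝ)..x, g y) (g x) x := fun x =>
    intervalIntegral.integral_hasDerivAt_right (h.continuous.intervalIntegrable _ _)
      (h.continuous.stronglyMeasurableAtFilter _ _) h.continuous.continuousAt
  have hderiv : deriv (fun x => ∫ y in (0 : ℝ)..x, g y) = g := funext fun x => (hder x).deriv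
  have hz : ∀ x, x ∉ Icc a b → g x = 0 := fun x hx =>
    image_eq_zero_of_notMem_tsupport fun h' => hx (hs h')
  have hsub : tsupport (fun x => ∫ y in (0 : ℝ)..x, g y) ⊆ Icc a b := by
    refine closure_minimal ?_ isClosed_Icc
    intro x hx
    by_contra hn
    apply hx
    rcases lt_or_ge x a with hxa | hxa
    · refine (intervalIntegral.integral_congr (g := fun _ => (0 : ℝ)) ?_).trans (by simp)
      intro y hy
      refine hz y fun hy' => ?_
      have := hy.2
      have h3 : max 0 x < a := max_lt ha hxa
      linarith [hy'.1, this.trans_lt h3]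
    · have hxb : b < x := by
        by_contra hle
        exact hn ⟨hxa, not_lt.1 hle⟩
      have hsplit := intervalIntegral.integral_add_adjacent_intervals
        (h.continuous.intervalIntegrable (μ := volume) 0 π)
        (h.continuous.intervalIntegrable (μ := volume) π x)
      rw [h0, zero_add] at hsplit
      change ∫ y in (0 : ℝ)..x, g y = 0
      rw [← hsplit]
      refine (intervalIntegral.integral_congr (g := fun _ => (0 : ℝ)) ?_).trans (by simp)
      intro y hy
      refine hz y fun hy' => ?_
      have := hy.1
      have h3 : b < min π x := lt_min hb hxb
      linarith [hy'.2, h3.trans_le this]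
  refine ⟨⟨?_, isCompact_Icc.of_isClosed_subset (isClosed_tsupport _) hsub,
    hsub.trans fun x hx => ⟨ha.trans_le hx.1, hx.2.trans_lt hb⟩⟩, hderiv⟩
  have : (∞ : WithTop ℕ∞) = ∞ + 1 := rfl
  rw [this, contDiff_succ_iff_deriv, hderiv]
  exact ⟨fun x => (hder x).differentiableAt, by simp, h.smooth⟩

lemma exists_testFunction_integral_eq_one :
    ∃ η : ℝ → ℝ, IsTestFunction η ∧ ∫ x in (0 : ℝ)..π, η x = 1 := by
  have hπ := Real.pi_pos
  let B : ContDiffBump (π / 2) := ⟨π / 8, π / 4, by positivity, by linarith⟩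
  have hsupp : tsupport (B.normed volume) ⊆ Ioo 0 π := by
    rw [B.tsupport_normed_eq, Real.closedBall_eq_Icc]
    intro x hx
    have h1 : B.rOut = π / 4 := rfl
    rw [h1] at hx
    constructor <;> linarith [hx.1, hx.2]
  refine ⟨B.normed volume, ⟨B.contDiff_normed, B.hasCompactSupport_normed, hsupp⟩, ?_⟩
  rw [intervalIntegral.integral_of_le hπ.le, integral_Ioc_eq_integral_Ioo,
    setIntegral_eq_integral_of_forall_compl_eq_zero, B.integral_normed]
  intro x hx
  exact image_eq_zero_of_notMem_tsupport fun h => hx (hsupp h)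

/-- A smooth function vanishing at `0` and `π` belongs to `H^1_0(0, π)`: approximate its derivative
in `L²` by test functions of mean zero and integrate. -/
lemma mem_closure_testPairs {W : ℝ → ℝ} (hW : Continuous W) (hW' : Continuous (deriv W))
    (hd : Differentiable ℝ W) (h0 : W 0 = 0) (hπ : W π = 0) :
    (contL2 W hW, contL2 (deriv W) hW') ∈ testPairs.topologicalClosure := by
  obtain ⟨η, hη, hη1⟩ := exists_testFunction_integral_eq_one
  set A := ‖contL2 η hη.continuous‖
  have hone := oneNorm_nonneg
  have hpi := Real.pi_pos
  have hA : 0 ≤ A := norm_nonneg _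
  have hWint : ∀ x, ∫ y in (0 : ℝ)..x, deriv W y = W x := by
    intro x
    rw [intervalIntegral.integral_deriv_eq_sub (fun y _ => hd y) (hW'.intervalIntegrable _ _), h0,
      sub_zero]
  rw [← SetLike.mem_coe, Submodule.topologicalClosure_coe, Metric.mem_closure_iff]
  intro ε hε
  obtain ⟨δ, hδ, hδε⟩ : ∃ δ > 0, (1 + oneNorm * oneNorm) * ((1 + oneNorm * A) * δ) < ε := by
    refine ⟨ε / (2 * ((1 + oneNorm * oneNorm) * (1 + oneNorm * A))), by positivity, ?_⟩
    have : 0 < (1 + oneNorm * oneNorm) * (1 + oneNorm * A) := by positivity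
    rw [← mul_assoc]
    field_simp
    linarith
  obtain ⟨ψ, hψ, hnear⟩ := exists_testFunction_near (contL2 (deriv W) hW') hδ
  set c := ∫ x in (0 : ℝ)..π, ψ x
  rw [contL2_sub] at hnear
  have hcs : Continuous (fun x => ψ x - deriv W x) := hψ.continuous.sub hW'
  have hcη : Continuous (fun x => c * η x) := continuous_const.mul hη.continuous
  have hc : |c| ≤ oneNorm * δ := by
    have h1 : c = ∫ x in (0 : ℝ)..π, (ψ x - deriv W x) := by
      rw [intervalIntegral.integral_sub (hψ.continuous.intervalIntegrable _ _)
        (hW'.intervalIntegrable _ _), hWint, hπ, sub_zero]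
    rw [h1]
    refine (abs_integral_le_norm hcs hpi.le le_rfl).trans ?_
    gcongr
  have hg : IsTestFunction (fun x => ψ x - c * η x) := hψ.sub_smul hη c
  have hg0 : ∫ x in (0 : ℝ)..π, (ψ x - c * η x) = 0 := by
    rw [intervalIntegral.integral_sub (hψ.continuous.intervalIntegrable _ _)
      (hcη.intervalIntegrable _ _),
      intervalIntegral.integral_const_mul, hη1, mul_one, sub_self]
  obtain ⟨hφ, hφ'⟩ := hg.primitive hg0
  have hgn : ‖contL2 _ hg.continuous - contL2 (deriv W) hW'‖ ≤ (1 + oneNorm * A) * δ := by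
    have : contL2 _ hg.continuous - contL2 (deriv W) hW'
        = contL2 _ hcs - c • contL2 η hη.continuous := by
      rw [← contL2_sub hψ.continuous hW', contL2_smul, sub_right_comm, contL2_sub hψ.continuous]
    rw [this]
    refine (norm_sub_le _ _).trans ?_
    rw [norm_smul, Real.norm_eq_abs]
    have : |c| * A ≤ oneNorm * δ * A := by gcongr
    change _ + |c| * A ≤ _
    linarith
  refine ⟨_, hφ.mem_testPairs, ?_⟩
  simp only [hφ']
  rw [dist_comm, Prod.dist_eq]
  simp only [dist_eq_norm]
  refine max_lt ?_ ?_
  · rw [contL2_sub]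
    refine (norm_contL2_le _ (C := oneNorm * ((1 + oneNorm * A) * δ)) (by positivity)
      ?_).trans_lt ?_
    · intro x hx
      have h1 : (∫ y in (0 : ℝ)..x, (ψ y - c * η y)) - W x
          = ∫ y in (0 : ℝ)..x, (ψ y - c * η y - deriv W y) := by
        rw [intervalIntegral.integral_sub (hg.continuous.intervalIntegrable _ _)
        (hW'.intervalIntegrable _ _), hWint]
      rw [h1]
      refine (abs_integral_le_norm (hg.continuous.sub hW') hx.1.le hx.2.le).trans ?_
      gcongr
      rwa [contL2_sub] at hgn
    · refine lt_of_le_of_lt ?_ hδε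
      rw [← mul_assoc]
      gcongr
      linarith
  · refine hgn.trans_lt (lt_of_le_of_lt ?_ hδε)
    refine le_mul_of_one_le_left (by positivity) ?_
    nlinarith

/-- Integration by parts of an element of `H^1_0` against a function smooth up to the boundary. -/
lemma H10.inner_dx (w : H10) {ψ : ℝ → ℝ} (hψ : Continuous ψ) (hψ' : Continuous (deriv ψ))
    (hd : Differentiable ℝ ψ) :
    inner ℝ w.dx (contL2 ψ hψ) = - inner ℝ w.fn (contL2 (deriv ψ) hψ') := by
  have hclosed : IsClosed {p : L2 × L2 | inner ℝ p.2 (contL2 ψ hψ)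
      = - inner ℝ p.1 (contL2 (deriv ψ) hψ')} := by
    refine isClosed_eq ?_ ?_
    · exact continuous_snd.inner continuous_const
    · exact (continuous_fst.inner continuous_const).neg
  refine (closure_minimal ?_ hclosed) w.2
  rintro p ⟨φ, hφ, h1, h2⟩
  rw [mem_ofPred_eq, inner_contL2, inner_contL2]
  have e1 : ∫ x in Ioo 0 π, p.2 x * ψ x = ∫ x in (0 : ℝ)..π, deriv φ x * ψ x := by
    rw [intervalIntegral.integral_of_le Real.pi_pos.le, integral_Ioc_eq_integral_Ioo]
    refine integral_congr_ae ?_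
    filter_upwards [h2] with x hx using by rw [hx]
  have e2 : ∫ x in Ioo 0 π, p.1 x * deriv ψ x = ∫ x in (0 : ℝ)..π, φ x * deriv ψ x := by
    rw [intervalIntegral.integral_of_le Real.pi_pos.le, integral_Ioc_eq_integral_Ioo]
    refine integral_congr_ae ?_
    filter_upwards [h1] with x hx using by rw [hx]
  have hz : ∀ x, x ∉ Ioo 0 π → φ x = 0 := fun x hx =>
    image_eq_zero_of_notMem_tsupport fun h' => hx (hφ.support_subset h')
  rw [e1, e2, intervalIntegral.integral_mul_deriv_eq_deriv_mul
    (fun x _ => (hφ.smooth.differentiable (by simp) x).hasDerivAt) (fun x _ => (hd x).hasDerivAt)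
    (hφ.continuous_deriv.intervalIntegrable _ _) (hψ'.intervalIntegrable _ _),
    hz 0 (by simp), hz π (by simp)]
  ring

/-- The element of `H^1_0(0, π)` given by a test function. -/
def IsTestFunction.toH10 {φ : ℝ → ℝ} (h : IsTestFunction φ) : H10 :=
  ⟨_, Submodule.le_topologicalClosure _ h.mem_testPairs⟩

/-! ### Travelling waves with a smooth periodic profile -/

/-- A smooth `2π`-periodic profile. -/
structure SmoothPeriodic (θ : ℝ → ℝ) : Prop where
  smooth : ContDiff ℝ ∞ θ
  periodic : Function.Periodic θ (2 * π)

namespace SmoothPeriodic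

variable {θ : ℝ → ℝ}

lemma continuous (h : SmoothPeriodic θ) : Continuous θ := h.smooth.continuous

lemma differentiable (h : SmoothPeriodic θ) : Differentiable ℝ θ :=
  h.smooth.differentiable (by simp)

lemma deriv (h : SmoothPeriodic θ) : SmoothPeriodic (deriv θ) := by
  refine ⟨?_, fun x => ?_⟩
  · have : (∞ : WithTop ℕ∞) = ∞ + 1 := rfl
    exact (contDiff_succ_iff_deriv.1 (this ▸ h.smooth)).2.2
  · rw [← deriv_comp_add_const]
    exact congrArg (fun f => _root_.deriv f x) (funext h.periodic)

lemma exists_bound (h : SmoothPeriodic θ) : ∃ C, 0 ≤ C ∧ ∀ x, |θ x| ≤ C := by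
  obtain ⟨C, hC⟩ := (isCompact_Icc (a := (0 : ℝ)) (b := 2 * π)).exists_bound_of_continuousOn
    h.continuous.continuousOn
  have key : ∀ x, |θ x| ≤ C := fun x => by
    obtain ⟨y, hy, hxy⟩ := h.periodic.exists_mem_Ico₀ Real.two_pi_pos x
    rw [hxy]
    exact hC y (Ico_subset_Icc_self hy)
  exact ⟨C, (abs_nonneg _).trans (key 0), key⟩

/-- First-order Taylor estimate, uniform on the line. -/
lemma exists_taylor_bound (h : SmoothPeriodic θ) : ∃ C, 0 ≤ C ∧
    ∀ p q, |θ q - θ p - (q - p) * _root_.deriv θ p| ≤ C * |q - p| ^ 2 := by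
  obtain ⟨C, hC, hb⟩ := h.deriv.deriv.exists_bound
  refine ⟨C, hC, fun p q => ?_⟩
  have hlip : ∀ x, |_root_.deriv θ x - _root_.deriv θ p| ≤ C * |x - p| := fun x =>
    convex_univ.norm_image_sub_le_of_norm_deriv_le (fun y _ => h.deriv.differentiable y)
      (fun y _ => hb y) (mem_univ p) (mem_univ x)
  have hder : ∀ x, HasDerivAt (fun s => θ s - s * _root_.deriv θ p)
      (_root_.deriv θ x - 1 * _root_.deriv θ p) x := fun x =>
    (h.differentiable x).hasDerivAt.sub ((hasDerivAt_id x).mul_const _)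
  have := (convex_uIcc p q).norm_image_sub_le_of_norm_deriv_le (𝕜 := ℝ) (C := C * |q - p|)
    (fun x _ => (hder x).differentiableAt) (fun x hx => by
      rw [(hder x).deriv, one_mul]
      refine (hlip x).trans ?_
      gcongr ?_ * ?_
      exact abs_sub_left_of_mem_uIcc hx) left_mem_uIcc right_mem_uIcc
  calc |θ q - θ p - (q - p) * _root_.deriv θ p|
      = |θ q - q * _root_.deriv θ p - (θ p - p * _root_.deriv θ p)| := by ring_nf
    _ ≤ C * |q - p| * |q - p| := this
    _ = _ := by ring

/-- The function `x ↦ θ (t + κ x)`, as an element of `L²(0, π)`. -/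
def shift (h : SmoothPeriodic θ) (κ t : ℝ) : L2 :=
  contL2 (fun x => θ (t + κ * x)) (h.continuous.comp (by fun_prop))

lemma hasDerivAt_shift (h : SmoothPeriodic θ) (κ t : ℝ) :
    HasDerivAt (h.shift κ) (h.deriv.shift κ t) t := by
  obtain ⟨C, hC, hT⟩ := h.exists_taylor_bound
  rw [hasDerivAt_iff_isLittleO]
  have hO : (fun s => h.shift κ s - h.shift κ t - (s - t) • h.deriv.shift κ t)
      =O[𝓝 t] fun s => (s - t) ^ 2 := by
    refine Asymptotics.IsBigO.of_bound (oneNorm * C) (Eventually.of_forall fun s => ?_)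
    rw [shift, shift, shift, contL2_smul, contL2_sub, contL2_sub, norm_pow, Real.norm_eq_abs,
      mul_assoc]
    refine norm_contL2_le _ (by positivity) fun x _ => ?_
    have := hT (t + κ * x) (s + κ * x)
    rwa [show s + κ * x - (t + κ * x) = s - t by ring] at this
  refine hO.trans_isLittleO ?_
  have := (Asymptotics.isLittleO_pow_pow (𝕜 := ℝ) (m := 1) (n := 2) one_lt_two).comp_tendsto
    (show Tendsto (fun s => s - t) (𝓝 t) (𝓝 0) by
      simpa using (show Continuous fun s : ℝ => s - t by fun_prop).tendsto t)
  simpa [Function.comp_def] using this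

/-- The function `x ↦ θ (t + x) + θ (t - x)`. -/
def sumFun (θ : ℝ → ℝ) (t x : ℝ) : ℝ := θ (t + x) + θ (t - x)

/-- The function `x ↦ θ (t + x) - θ (t - x)`. -/
def diffFun (θ : ℝ → ℝ) (t x : ℝ) : ℝ := θ (t + x) - θ (t - x)

lemma continuous_sumFun (h : SmoothPeriodic θ) (t : ℝ) : Continuous (sumFun θ t) :=
  (h.continuous.comp (by fun_prop)).add (h.continuous.comp (by fun_prop))

lemma continuous_diffFun (h : SmoothPeriodic θ) (t : ℝ) : Continuous (diffFun θ t) :=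
  (h.continuous.comp (by fun_prop)).sub (h.continuous.comp (by fun_prop))

/-- `sumFun θ t` as an element of `L²(0, π)`. -/
def sumWave (h : SmoothPeriodic θ) (t : ℝ) : L2 := contL2 (sumFun θ t) (h.continuous_sumFun t)

/-- `diffFun θ t` as an element of `L²(0, π)`. -/
def diffWave (h : SmoothPeriodic θ) (t : ℝ) : L2 := contL2 (diffFun θ t) (h.continuous_diffFun t)

lemma hasDerivAt_sumWave (h : SmoothPeriodic θ) (t : ℝ) :
    HasDerivAt h.sumWave (h.deriv.sumWave t) t := by
  have e : ∀ {η : ℝ → ℝ} (k : SmoothPeriodic η) (s : ℝ),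
      k.shift 1 s + k.shift (-1) s = k.sumWave s := fun k s => by
    rw [shift, shift, contL2_add, sumWave]
    congr 1
    ext x
    simp [sumFun, sub_eq_add_neg]
  have := (h.hasDerivAt_shift 1 t).add (h.hasDerivAt_shift (-1) t)
  rw [e] at this
  exact this.congr_of_eventuallyEq (Eventually.of_forall fun s => (e h s).symm)

lemma hasDerivAt_diffWave (h : SmoothPeriodic θ) (t : ℝ) :
    HasDerivAt h.diffWave (h.deriv.diffWave t) t := by
  have e : ∀ {η : ℝ → ℝ} (k : SmoothPeriodic η) (s : ℝ),
      k.shift 1 s - k.shift (-1) s = k.diffWave s := fun k s => by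
    rw [shift, shift, contL2_sub, diffWave]
    congr 1
    ext x
    simp [diffFun, sub_eq_add_neg]
  have := (h.hasDerivAt_shift 1 t).sub (h.hasDerivAt_shift (-1) t)
  rw [e] at this
  exact this.congr_of_eventuallyEq (Eventually.of_forall fun s => (e h s).symm)

lemma hasDerivAt_diffFun (h : SmoothPeriodic θ) (t x : ℝ) :
    HasDerivAt (diffFun θ t) (sumFun (_root_.deriv θ) t x) x := by
  have h1 := (h.differentiable (t + x)).hasDerivAt.comp_const_add t x
  have h2 := (h.differentiable (t - x)).hasDerivAt.comp_const_sub t x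
  exact (h1.sub h2).congr_deriv (by simp [sumFun])

lemma hasDerivAt_sumFun (h : SmoothPeriodic θ) (t x : ℝ) :
    HasDerivAt (sumFun θ t) (diffFun (_root_.deriv θ) t x) x := by
  have h1 := (h.differentiable (t + x)).hasDerivAt.comp_const_add t x
  have h2 := (h.differentiable (t - x)).hasDerivAt.comp_const_sub t x
  exact (h1.add h2).congr_deriv (by simp [diffFun, sub_eq_add_neg])

lemma deriv_diffFun (h : SmoothPeriodic θ) (t : ℝ) :
    _root_.deriv (diffFun θ t) = sumFun (_root_.deriv θ) t :=
  funext fun x => (h.hasDerivAt_diffFun t x).deriv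

lemma deriv_sumFun (h : SmoothPeriodic θ) (t : ℝ) :
    _root_.deriv (sumFun θ t) = diffFun (_root_.deriv θ) t :=
  funext fun x => (h.hasDerivAt_sumFun t x).deriv

lemma pair_mem_closure (h : SmoothPeriodic θ) (t : ℝ) :
    (h.diffWave t, h.deriv.sumWave t) ∈ testPairs.topologicalClosure := by
  have h1 : diffFun θ t 0 = 0 := by simp [diffFun]
  have h2 : diffFun θ t π = 0 := by
    rw [diffFun, ← h.periodic (t - π)]
    ring_nf
  have := mem_closure_testPairs (h.continuous_diffFun t)
    (by rw [h.deriv_diffFun]; exact h.deriv.continuous_sumFun t)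
    (fun x => (h.hasDerivAt_diffFun t x).differentiableAt) h1 h2
  simp only [h.deriv_diffFun] at this
  exact this

/-- The state `θ (t + x) - θ (t - x)` of a standing wave as an element of `H^1_0(0, π)`. -/
def wave (h : SmoothPeriodic θ) (t : ℝ) : H10 := ⟨_, h.pair_mem_closure t⟩

lemma inner_dx_sumWave (h : SmoothPeriodic θ) (w : H10) (t : ℝ) :
    inner ℝ w.dx (h.sumWave t) = - inner ℝ w.fn (h.deriv.diffWave t) := by
  have := w.inner_dx (h.continuous_sumFun t)
    (by rw [h.deriv_sumFun]; exact h.deriv.continuous_diffFun t)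
    (fun x => (h.hasDerivAt_sumFun t x).differentiableAt)
  simp only [h.deriv_sumFun] at this
  exact this

lemma hasWeakDeriv_sumWave (h : SmoothPeriodic θ) (t : ℝ) :
    HasWeakDeriv (h.deriv.sumWave t) (h.deriv.deriv.diffWave t) := by
  intro φ hφ
  have := h.deriv.inner_dx_sumWave hφ.toH10 t
  have e1 : hφ.toH10.dx = contL2 (_root_.deriv φ) hφ.continuous_deriv := rfl
  have e2 : hφ.toH10.fn = contL2 φ hφ.continuous := rfl
  rwa [e1, e2, real_inner_comm, real_inner_comm _ (contL2 φ _), inner_contL2, inner_contL2] at this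

lemma continuous_wave (h : SmoothPeriodic θ) : Continuous h.wave := by
  refine Continuous.subtype_mk (Continuous.prodMk ?_ ?_) _
  · exact continuous_iff_continuousAt.2 fun t => (h.hasDerivAt_diffWave t).continuousAt
  · exact continuous_iff_continuousAt.2 fun t => (h.deriv.hasDerivAt_sumWave t).continuousAt

/-- d'Alembert's formula: `θ (t + x) - θ (t - x)` is a strong solution. -/
lemma isStrongSolution (h : SmoothPeriodic θ) :
    IsStrongSolution (h.wave 0) (h.deriv.diffWave 0) h.wave h.deriv.diffWave where
  continuousOn := h.continuous_wave.continuousOn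
  hasDeriv t _ := (h.hasDerivAt_diffWave t).hasDerivWithinAt
  continuousOn_deriv :=
    (continuous_iff_continuousAt.2 fun t =>
      (h.deriv.hasDerivAt_diffWave t).continuousAt).continuousOn
  equation w t _ := by
    have h1 := (h.deriv.hasDerivAt_diffWave t).inner ℝ (hasDerivAt_const t w.fn)
    rw [inner_zero_right, zero_add] at h1
    have h2 : inner ℝ (h.deriv.deriv.diffWave t) w.fn = - inner ℝ (h.wave t).dx w.dx := by
      rw [real_inner_comm, real_inner_comm w.dx]
      have := h.deriv.inner_dx_sumWave w t
      change _ = - inner ℝ w.dx (h.deriv.sumWave t)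
      linarith
    exact (h1.congr_deriv h2).hasDerivWithinAt
  initial_fn := rfl
  initial_deriv := rfl
  data_fn := ⟨h.deriv.deriv.diffWave 0, h.hasWeakDeriv_sumWave 0⟩
  data_deriv := ⟨h.deriv.wave 0, rfl⟩
  regular := ⟨h.deriv.deriv.diffWave,
    (continuous_iff_continuousAt.2 fun t =>
      (h.deriv.deriv.hasDerivAt_diffWave t).continuousAt).continuousOn,
    fun t _ => (h.deriv.hasDerivAt_diffWave t).hasDerivWithinAt,
    fun t _ => h.hasWeakDeriv_sumWave t⟩

end SmoothPeriodic

/-- Conservation law along strong solutions.  Up to a factor `2` the conserved quantity is the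
integral of `θ` against the transported Riemann invariant of the solution. -/
lemma IsStrongSolution.conserved {u₀ : H10} {u₁ : L2} {u : ℝ → H10} {v : ℝ → L2}
    (hu : IsStrongSolution u₀ u₁ u v) {θ : ℝ → ℝ} (h : SmoothPeriodic θ) {t : ℝ} (ht : 0 ≤ t) :
    inner ℝ (u t).dx (h.sumWave t) + inner ℝ (v t) (h.diffWave t)
      = inner ℝ u₀.dx (h.sumWave 0) + inner ℝ u₁ (h.diffWave 0) := by
  obtain ⟨a, -, hva, -⟩ := hu.regular
  set Q : ℝ → ℝ := fun s => inner ℝ (u s).dx (h.sumWave s) + inner ℝ (v s) (h.diffWave s)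
  have hQ : ∀ s, 0 ≤ s → HasDerivWithinAt Q 0 (Ici 0) s := by
    intro s hs
    -- `u` is differentiable in time only as an `L²` function, so `u_x` is integrated by parts
    have hQ' : Q = fun s => - inner ℝ (u s).fn (h.deriv.diffWave s)
        + inner ℝ (v s) (h.diffWave s) := funext fun s => by
      simp only [Q, h.inner_dx_sumWave]
    have h1 := (hu.hasDeriv s hs).inner ℝ (h.deriv.hasDerivAt_diffWave s).hasDerivWithinAt
    have h2 := (hva s hs).inner ℝ (h.hasDerivAt_diffWave s).hasDerivWithinAt
    have h3 : inner ℝ (a s) (h.diffWave s) = inner ℝ (u s).fn (h.deriv.deriv.diffWave s) := by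
      have e1 := hu.equation (h.wave s) s hs
      have e2 := (hva s hs).inner ℝ (hasDerivWithinAt_const s (Ici 0) (h.wave s).fn)
      rw [inner_zero_right, zero_add] at e2
      have e3 := ((uniqueDiffOn_Ici (0 : ℝ)) s hs).eq_deriv _ e2 e1
      have e4 := h.deriv.inner_dx_sumWave (u s) s
      change inner ℝ (a s) (h.diffWave s) = - inner ℝ (u s).dx (h.deriv.sumWave s) at e3
      rw [e3, e4, neg_neg]
    rw [hQ']
    refine (h1.neg.add h2).congr_deriv ?_
    rw [h3]
    ring
  have hconst := constant_of_derivWithin_zero (f := Q) (a := 0) (b := t)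
    (fun s hs => ((hQ s hs.1).mono Icc_subset_Ici_self).differentiableWithinAt)
    (fun s hs => ((hQ s hs.1).mono Icc_subset_Ici_self).derivWithin
      (uniqueDiffOn_Icc (hs.1.trans_lt hs.2) s (Ico_subset_Icc_self hs))) t ⟨ht, le_rfl⟩
  change Q t = _
  rw [hconst]
  simp only [Q, hu.initial_fn, hu.initial_deriv]

/-! ### The Riemann invariant and the boundary traces -/

/-- The Riemann invariant of the state `(u, u_t)`, where `U = u_x` and `V = u_t`, on `(-π, π)`:
it is `(u_x + u_t) / 2` on `(0, π)`, and the reflection of `(u_x - u_t) / 2` on `(-π, 0)`. -/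
def riemannBase (U V : L2) (y : ℝ) : ℝ :=
  if 0 < y then (U y + V y) / 2 else (U (-y) - V (-y)) / 2

/-- The `2π`-periodic extension of `riemannBase`. -/
def riemann (U V : L2) (s : ℝ) : ℝ :=
  riemannBase U V (2 * π * Int.fract ((s + π) / (2 * π)) - π)

variable (U V : L2)

lemma riemann_periodic : Function.Periodic (riemann U V) (2 * π) := fun s => by
  have : (s + 2 * π + π) / (2 * π) = (s + π) / (2 * π) + 1 := by
    field_simp
    ring
  rw [riemann, riemann, this, Int.fract_add_one]

lemma riemann_of_mem {s : ℝ} (hs : s ∈ Ico (-π) π) : riemann U V s = riemannBase U V s := by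
  have hpi := Real.two_pi_pos
  have : Int.fract ((s + π) / (2 * π)) = (s + π) / (2 * π) := by
    rw [Int.fract_eq_self]
    constructor
    · exact div_nonneg (by linarith [hs.1]) hpi.le
    · rw [div_lt_one hpi]
      linarith [hs.2]
  rw [riemann, this]
  congr 1
  field_simp
  ring

lemma riemann_of_pos {x : ℝ} (hx : x ∈ Ioo 0 π) : riemann U V x = (U x + V x) / 2 := by
  rw [riemann_of_mem U V ⟨by linarith [hx.1, hx.2], hx.2⟩, riemannBase, if_pos hx.1]

lemma riemann_neg {x : ℝ} (hx : x ∈ Ioo 0 π) : riemann U V (-x) = (U x - V x) / 2 := by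
  rw [riemann_of_mem U V ⟨by linarith [hx.2], by linarith [hx.1, hx.2]⟩, riemannBase,
    if_neg (by linarith [hx.1]), neg_neg]

lemma measurable_riemann : Measurable (riemann U V) := by
  have hU : Measurable U := (Lp.stronglyMeasurable U).measurable
  have hV : Measurable V := (Lp.stronglyMeasurable V).measurable
  have : Measurable (riemannBase U V) := by
    refine Measurable.ite measurableSet_Ioi ?_ ?_ <;> fun_prop
  exact this.comp ((((measurable_id.add_const _).div_const _).fract.const_mul _).sub_const _)

lemma integrableOn_L2 (f : L2) : IntegrableOn f (Ioo 0 π) volume :=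
  (Lp.memLp f).integrable (by norm_num)

lemma intervalIntegrable_of_Ioo {f : ℝ → ℝ} {a b : ℝ} (hab : a ≤ b)
    (h : IntegrableOn f (Ioo a b) volume) : IntervalIntegrable f volume a b := by
  rwa [intervalIntegrable_iff_integrableOn_Ioo_of_le hab]

lemma integral_Ioo_eq {f : ℝ → ℝ} {a b : ℝ} (hab : a ≤ b) :
    ∫ x in Ioo a b, f x = ∫ x in a..b, f x := by
  rw [intervalIntegral.integral_of_le hab, integral_Ioc_eq_integral_Ioo]

lemma integrableOn_riemann_pos : IntegrableOn (riemann U V) (Ioo 0 π) volume :=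
  IntegrableOn.congr_fun (f := fun x => (U x + V x) / 2)
    (((integrableOn_L2 U).add (integrableOn_L2 V)).div_const 2)
    (fun _ hx => (riemann_of_pos U V hx).symm) measurableSet_Ioo

lemma integrableOn_riemann_neg : IntegrableOn (fun x => riemann U V (-x)) (Ioo 0 π) volume :=
  IntegrableOn.congr_fun (f := fun x => (U x - V x) / 2)
    (((integrableOn_L2 U).sub (integrableOn_L2 V)).div_const 2)
    (fun _ hx => (riemann_neg U V hx).symm) measurableSet_Ioo

lemma intervalIntegrable_riemann (a b : ℝ) : IntervalIntegrable (riemann U V) volume a b := by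
  refine (riemann_periodic U V).intervalIntegrable (t := -π) Real.two_pi_pos.ne' ?_ a b
  rw [show -π + 2 * π = π by ring]
  refine IntervalIntegrable.trans (b := 0) ?_
    (intervalIntegrable_of_Ioo Real.pi_pos.le (integrableOn_riemann_pos U V))
  have := (intervalIntegrable_of_Ioo Real.pi_pos.le (integrableOn_riemann_neg U V)).comp_sub_left 0
  simpa using this.symm

lemma locallyIntegrable_riemann : LocallyIntegrable (riemann U V) volume := by
  rw [locallyIntegrable_iff]
  intro K hK
  obtain ⟨a, b, hab⟩ : ∃ a b, K ⊆ Icc a b := by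
    obtain ⟨r, hr⟩ := hK.isBounded.subset_closedBall 0
    exact ⟨_, _, Real.closedBall_eq_Icc ▸ hr⟩
  rcases le_or_gt a b with h | h
  · have := (intervalIntegrable_iff_integrableOn_Icc_of_le h).1 (intervalIntegrable_riemann U V a b)
    exact this.mono_set hab
  · rw [Icc_eq_empty h.not_ge, subset_empty_iff] at hab
    simp [hab]

/-- The indicator of the `2π`-periodic translates of `(c - ε, c + ε)`. -/
def arc (c ε x : ℝ) : ℝ := if Real.cos ε < Real.cos (x - c) then 1 else 0

/-- Smooth periodic approximations of `arc`. -/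
def smoothArc (c ε : ℝ) (n : ℕ) (x : ℝ) : ℝ :=
  Real.smoothTransition (n * (Real.cos (x - c) - Real.cos ε))

lemma smoothPeriodic_smoothArc (c ε : ℝ) (n : ℕ) : SmoothPeriodic (smoothArc c ε n) where
  smooth := by
    refine Real.smoothTransition.contDiff.comp (contDiff_const.mul (ContDiff.sub ?_ contDiff_const))
    exact Real.contDiff_cos.comp (contDiff_id.sub contDiff_const)
  periodic x := by
    rw [smoothArc, smoothArc, show x + 2 * π - c = x - c + 2 * π by ring, Real.cos_add_two_pi]

lemma tendsto_smoothArc (c ε x : ℝ) :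
    Tendsto (fun n => smoothArc c ε n x) atTop (𝓝 (arc c ε x)) := by
  rw [arc]
  split_ifs with h
  · have h1 : Tendsto (fun n : ℕ => (n : ℝ) * (Real.cos (x - c) - Real.cos ε)) atTop atTop :=
      tendsto_natCast_atTop_atTop.atTop_mul_const (sub_pos.2 h)
    refine tendsto_const_nhds.congr' ?_
    filter_upwards [h1.eventually_ge_atTop 1] with n hn
    exact (Real.smoothTransition.one_of_one_le hn).symm
  · refine tendsto_const_nhds.congr fun n => ?_
    exact (Real.smoothTransition.zero_of_nonpos
      (mul_nonpos_of_nonneg_of_nonpos n.cast_nonneg (by linarith))).symm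

lemma abs_smoothArc_le (c ε : ℝ) (n : ℕ) (x : ℝ) : |smoothArc c ε n x| ≤ 1 := by
  rw [smoothArc, abs_of_nonneg (Real.smoothTransition.nonneg _)]
  exact Real.smoothTransition.le_one _

lemma measurable_arc (c ε : ℝ) : Measurable (arc c ε) := by
  refine Measurable.ite ?_ measurable_const measurable_const
  exact measurableSet_lt measurable_const (by fun_prop)

lemma abs_arc_le (c ε x : ℝ) : |arc c ε x| ≤ 1 := by
  rw [arc]
  split_ifs <;> simp

lemma arc_periodic (c ε : ℝ) : Function.Periodic (arc c ε) (2 * π) := fun x => by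
  rw [arc, arc, show x + 2 * π - c = x - c + 2 * π by ring, Real.cos_add_two_pi]

lemma arc_of_abs_le {c ε x : ℝ} (h0 : 0 ≤ ε) (hπ : ε ≤ π) (hx : |x - c| ≤ π) :
    arc c ε x = if |x - c| < ε then 1 else 0 := by
  rw [arc]
  congr 1
  rw [← Real.cos_abs (x - c)]
  exact propext (Real.strictAntiOn_cos.lt_iff_gt ⟨h0, hπ⟩ ⟨abs_nonneg _, hx⟩)

variable {U V}

lemma tendsto_integral_smooth (f : L2) {g : ℕ → ℝ → ℝ} {k : ℝ → ℝ} (hg : ∀ n, Continuous (g n))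
    (hb : ∀ n x, |g n x| ≤ 2) (hlim : ∀ x, Tendsto (fun n => g n x) atTop (𝓝 (k x))) :
    Tendsto (fun n => inner ℝ f (contL2 (g n) (hg n))) atTop
      (𝓝 (∫ x in Ioo 0 π, f x * k x)) := by
  simp only [inner_contL2]
  have hf : Integrable f spaceMeasure := (Lp.memLp f).integrable (by norm_num)
  refine tendsto_integral_of_dominated_convergence (fun x => |f x| * 2) (fun n => ?_)
    (hf.abs.mul_const 2) (fun n => Eventually.of_forall fun x => ?_)
    (Eventually.of_forall fun x => (hlim x).const_mul _)
  · exact hf.aestronglyMeasurable.mul (hg n).aestronglyMeasurable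
  · rw [Real.norm_eq_abs, abs_mul]
    gcongr
    exact hb n x

lemma integrableOn_mul_arc {f : ℝ → ℝ} {s : Set ℝ} (hf : IntegrableOn f s volume) {k : ℝ → ℝ}
    (hk : Measurable k) (hb : ∀ x, |k x| ≤ 1) : IntegrableOn (fun x => f x * k x) s volume :=
  Integrable.mul_bdd (c := 1) hf hk.aestronglyMeasurable (Eventually.of_forall hb)

/-- The conserved quantity at time `0` is an integral over one period of the Riemann invariant. -/
lemma integral_initial_arc (c ε : ℝ) :
    (∫ x in Ioo 0 π, U x * SmoothPeriodic.sumFun (arc c ε) 0 x)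
      + (∫ x in Ioo 0 π, V x * SmoothPeriodic.diffFun (arc c ε) 0 x)
      = 2 * ∫ x in (-π)..π, riemann U V x * arc c ε x := by
  have hpi := Real.pi_pos.le
  have hm := measurable_arc c ε
  have hb := abs_arc_le c ε
  have iU := integrableOn_mul_arc (integrableOn_L2 U) hm hb
  have iV := integrableOn_mul_arc (integrableOn_L2 V) hm hb
  have iU' := integrableOn_mul_arc (integrableOn_L2 U) (hm.comp measurable_neg) fun x => hb (-x)
  have iV' := integrableOn_mul_arc (integrableOn_L2 V) (hm.comp measurable_neg) fun x => hb (-x)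
  have hr : ∀ a b, IntervalIntegrable (fun x => riemann U V x * arc c ε x) volume a b := by
    intro a b
    rw [intervalIntegrable_iff]
    exact integrableOn_mul_arc (intervalIntegrable_iff.1 (intervalIntegrable_riemann U V a b)) hm hb
  have e1 : ∫ x in (0 : ℝ)..π, riemann U V x * arc c ε x
      = ∫ x in Ioo 0 π, (U x * arc c ε x + V x * arc c ε x) / 2 := by
    rw [← integral_Ioo_eq hpi]
    refine setIntegral_congr_fun measurableSet_Ioo fun x hx => ?_
    simp only [riemann_of_pos U V hx]
    ring
  have e2 : ∫ x in (-π)..0, riemann U V x * arc c ε x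
      = ∫ x in Ioo 0 π, (U x * arc c ε (-x) - V x * arc c ε (-x)) / 2 := by
    have := intervalIntegral.integral_comp_neg (a := 0) (b := π)
      (fun x => riemann U V x * arc c ε x)
    rw [neg_zero] at this
    rw [← this, ← integral_Ioo_eq hpi]
    refine setIntegral_congr_fun measurableSet_Ioo fun x hx => ?_
    simp only [riemann_neg U V hx]
    ring
  rw [← intervalIntegral.integral_add_adjacent_intervals (hr (-π) 0) (hr 0 π), e1, e2,
    ← integral_add, ← integral_add, ← integral_const_mul]
  · refine setIntegral_congr_fun measurableSet_Ioo fun x _ => ?_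
    simp only [SmoothPeriodic.sumFun, SmoothPeriodic.diffFun, zero_add, zero_sub]
    ring
  · exact (iU'.sub iV').div_const 2
  · exact (iU.add iV).div_const 2
  · refine (iU.add iU').congr (Eventually.of_forall fun x => ?_)
    simp only [SmoothPeriodic.sumFun, zero_add, zero_sub, Pi.add_apply, Function.comp_apply]
    ring
  · refine (iV.sub iV').congr (Eventually.of_forall fun x => ?_)
    simp only [SmoothPeriodic.diffFun, zero_add, zero_sub, Pi.sub_apply, Function.comp_apply]
    ring

lemma integral_riemann_mul_arc {c ε : ℝ} (h0 : 0 < ε) (hε : ε < π) :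
    ∫ x in (-π)..π, riemann U V x * arc c ε x = ∫ x in (c - ε)..(c + ε), riemann U V x := by
  have hper : Function.Periodic (fun x => riemann U V x * arc c ε x) (2 * π) :=
    (riemann_periodic U V).mul (arc_periodic c ε)
  have h1 := hper.intervalIntegral_add_eq (-π) (c - π)
  rw [show -π + 2 * π = π by ring, show c - π + 2 * π = c + π by ring] at h1
  rw [h1, ← integral_Ioo_eq (by linarith), ← integral_Ioo_eq (by linarith)]
  have h2 : ∫ x in Ioo (c - π) (c + π), riemann U V x * arc c ε x
      = ∫ x in Ioo (c - π) (c + π), (Ioo (c - ε) (c + ε)).indicator (riemann U V) x := by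
    refine setIntegral_congr_fun measurableSet_Ioo fun x hx => ?_
    have hx' : |x - c| ≤ π := abs_le.2 ⟨by linarith [hx.1], by linarith [hx.2]⟩
    simp only [arc_of_abs_le h0.le hε.le hx', indicator_apply]
    have : |x - c| < ε ↔ x ∈ Ioo (c - ε) (c + ε) := by
      rw [abs_lt, mem_Ioo]
      constructor <;> rintro ⟨a, b⟩ <;> constructor <;> linarith
    simp only [this]
    split_ifs <;> simp
  rw [h2, setIntegral_indicator measurableSet_Ioo, inter_eq_right.2]
  exact Ioo_subset_Ioo (by linarith) (by linarith)

/-- Transport of the Riemann invariant, tested on an arc centred at `t` or `t + π`.  For these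
centres the arc is symmetric about the boundary point, and the contribution of `u_t` cancels. -/
lemma IsStrongSolution.integral_arc {u₀ : H10} {u₁ : L2} {u : ℝ → H10} {v : ℝ → L2}
    (hu : IsStrongSolution u₀ u₁ u v) {t c ε : ℝ} (ht : 0 ≤ t) (hc : c = t ∨ c = t + π)
    (h0 : 0 < ε) (hε : ε < π) :
    ∫ x in Ioo 0 π, (u t).dx x * arc c ε (t + x)
      = ∫ x in (c - ε)..(c + ε), riemann u₀.dx u₁ x := by
  have hcos : ∀ x, Real.cos (t - x - c) = Real.cos (t + x - c) := by
    intro x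
    rcases hc with rfl | rfl
    · rw [← Real.cos_neg]
      ring_nf
    · rw [← Real.cos_neg, ← Real.cos_sub_two_pi]
      ring_nf
  have hsymm : ∀ n x, smoothArc c ε n (t - x) = smoothArc c ε n (t + x) := fun n x => by
    rw [smoothArc, smoothArc, hcos]
  have hb2 : ∀ n s x, |SmoothPeriodic.sumFun (smoothArc c ε n) s x| ≤ 2 := fun n s x => by
    have h1 := abs_smoothArc_le c ε n (s + x)
    have h2 := abs_smoothArc_le c ε n (s - x)
    exact (abs_add_le _ _).trans (by linarith)
  have hb2' : ∀ n s x, |SmoothPeriodic.diffFun (smoothArc c ε n) s x| ≤ 2 := fun n s x => by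
    have h1 := abs_smoothArc_le c ε n (s + x)
    have h2 := abs_smoothArc_le c ε n (s - x)
    exact (abs_sub _ _).trans (by linarith)
  have hs := fun n => smoothPeriodic_smoothArc c ε n
  have l1 := tendsto_integral_smooth (u t).dx (fun n => (hs n).continuous_sumFun t)
    (fun n => hb2 n t)
    (fun x => (tendsto_smoothArc c ε (t + x)).add (tendsto_smoothArc c ε (t - x)))
  have l2 := tendsto_integral_smooth u₀.dx (fun n => (hs n).continuous_sumFun 0)
    (fun n => hb2 n 0)
    (fun x => (tendsto_smoothArc c ε (0 + x)).add (tendsto_smoothArc c ε (0 - x)))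
  have l3 := tendsto_integral_smooth u₁ (fun n => (hs n).continuous_diffFun 0)
    (fun n => hb2' n 0)
    (fun x => (tendsto_smoothArc c ε (0 + x)).sub (tendsto_smoothArc c ε (0 - x)))
  have hz : ∀ n, inner ℝ (v t) ((hs n).diffWave t) = 0 := fun n => by
    rw [SmoothPeriodic.diffWave, inner_contL2]
    simp [SmoothPeriodic.diffFun, hsymm]
  have hlim := tendsto_nhds_unique (l1.congr fun n => ?_) (l2.add l3)
  · have e := integral_initial_arc (U := u₀.dx) (V := u₁) c ε
    rw [integral_riemann_mul_arc h0 hε] at e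
    have e' := hlim.trans e
    have e3 : ∫ x in Ioo 0 π, (u t).dx x * (arc c ε (t + x) + arc c ε (t - x))
        = 2 * ∫ x in Ioo 0 π, (u t).dx x * arc c ε (t + x) := by
      rw [← integral_const_mul]
      refine integral_congr_ae (Eventually.of_forall fun x => ?_)
      have : arc c ε (t - x) = arc c ε (t + x) := by rw [arc, arc, hcos]
      simp only [this]
      ring
    linarith
  · have := hu.conserved (hs n) ht
    rw [hz, add_zero] at this
    exact this

/-- The classical traces are given by the Riemann invariant of the data: both sides of
`IsStrongSolution.integral_arc` are differentiated with respect to the width of the arc, using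
Lebesgue's differentiation theorem for the invariant. -/
lemma IsStrongSolution.trace_eq {u₀ : H10} {u₁ : L2} {u : ℝ → H10} {v : ℝ → L2}
    (hu : IsStrongSolution u₀ u₁ u v) {x₀ : ℝ} (hx₀ : x₀ ∈ ({0, π} : Set ℝ)) :
    ∀ᵐ t : ℝ, 0 ≤ t → ∀ b, HasTraceAt (u t).dx x₀ b → b = 2 * riemann u₀.dx u₁ (t + x₀) := by
  set F := riemann u₀.dx u₁
  have hpi := Real.pi_pos
  have hF : LocallyIntegrable F volume := locallyIntegrable_riemann _ _
  have hae := (measurePreserving_add_right volume x₀).quasiMeasurePreserving.ae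
    (LocallyIntegrable.ae_hasDerivAt_integral hF)
  filter_upwards [hae] with t hder ht b ⟨G, hG, hGae, hGb⟩
  -- the primitive of the invariant, differentiated symmetrically at `t + x₀`
  have hB : HasDerivAt (fun ε => ∫ x in (t + x₀ - ε)..(t + x₀ + ε), F x)
      (2 * F (t + x₀)) 0 := by
    have h1 : HasDerivAt (fun ε => ∫ x in (0 : ℝ)..(t + x₀ + ε), F x) (F (t + x₀)) 0 :=
      HasDerivAt.comp_const_add (t + x₀) 0 (by simpa using hder 0)
    have h2 : HasDerivAt (fun ε => ∫ x in (0 : ℝ)..(t + x₀ - ε), F x) (-F (t + x₀)) 0 :=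
      HasDerivAt.comp_const_sub (t + x₀) 0 (by simpa using hder 0)
    refine ((h1.sub h2).congr_deriv (by ring)).congr_of_eventuallyEq
      (Eventually.of_forall fun ε => ?_)
    exact (intervalIntegral.integral_interval_sub_left (intervalIntegrable_riemann _ _ _ _)
      (intervalIntegrable_riemann _ _ _ _)).symm
  set H : ℝ → ℝ := IccExtend hpi.le ((Icc 0 π).domRestrict G)
  have hH : Continuous H := hG.domRestrict.Icc_extend'
  have hHG : ∀ x ∈ Icc 0 π, H x = G x := fun x hx => by
    rw [show H x = _ from IccExtend_of_mem hpi.le _ hx, domRestrict_apply]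
  have hx₀' : x₀ ∈ Icc 0 π := by
    rcases hx₀ with rfl | rfl
    · exact ⟨le_rfl, hpi.le⟩
    · exact ⟨hpi.le, le_rfl⟩
  have hae' : ∀ᵐ x ∂spaceMeasure, (u t).dx x = H x := by
    filter_upwards [hGae, ae_restrict_mem measurableSet_Ioo] with x h1 h2
    rw [h1, hHG x (Ioo_subset_Icc_self h2)]
  -- the integral of the boundary layer of width `ε` at `x₀`
  obtain ⟨A, hA, hAint⟩ : ∃ A : ℝ → ℝ, HasDerivAt A (H x₀) 0 ∧ ∀ ε, 0 ≤ ε → ε < π →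
      A ε = ∫ x in Ioo 0 π, H x * (if |x - x₀| < ε then 1 else 0) := by
    have hint : ∀ s : Set ℝ, MeasurableSet s → ∫ x in Ioo 0 π, H x * (s.indicator (fun _ => 1) x)
        = ∫ x in Ioo 0 π ∩ s, H x := by
      intro s hs
      rw [← setIntegral_indicator hs]
      refine integral_congr_ae (Eventually.of_forall fun x => ?_)
      by_cases hx : x ∈ s <;> simp [hx]
    have hball : ∀ ε, MeasurableSet {x : ℝ | |x - x₀| < ε} := fun ε =>
      measurableSet_lt (by fun_prop) measurable_const
    have hprim : HasDerivAt (fun x => ∫ y in (0 : ℝ)..x, H y) (H x₀) x₀ :=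
      intervalIntegral.integral_hasDerivAt_right (hH.intervalIntegrable _ _)
        (hH.stronglyMeasurableAtFilter _ _) hH.continuousAt
    rcases hx₀ with rfl | rfl
    · refine ⟨_, hprim, fun ε h0 h1 => ?_⟩
      have := hint _ (hball ε)
      simp only [indicator_apply, mem_ofPred_eq] at this
      rw [this, ← integral_Ioo_eq h0]
      congr 2
      ext x
      simp only [mem_inter_iff, mem_Ioo, mem_ofPred_eq, sub_zero, abs_lt]
      constructor
      · rintro ⟨a, b⟩
        exact ⟨⟨a, by linarith⟩, by linarith, b⟩
      · rintro ⟨⟨a, b⟩, c, d⟩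
        exact ⟨a, d⟩
    · have hlast : HasDerivAt (fun ε => ∫ y in (π - ε)..π, H y) (H π) 0 := by
        have h2 : HasDerivAt (fun ε => ∫ x in (0 : ℝ)..(π - ε), H x) (-H π) 0 :=
          HasDerivAt.comp_const_sub π 0 (by simpa using hprim)
        refine ((h2.const_sub (∫ x in (0 : ℝ)..π, H x)).congr_deriv (by ring)).congr_of_eventuallyEq
          (Eventually.of_forall fun ε => ?_)
        exact (intervalIntegral.integral_interval_sub_left (hH.intervalIntegrable _ _)
          (hH.intervalIntegrable _ _)).symm
      refine ⟨_, hlast, fun ε h0 h1 => ?_⟩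
      have := hint _ (hball ε)
      simp only [indicator_apply, mem_ofPred_eq] at this
      rw [this, ← integral_Ioo_eq (by linarith)]
      congr 2
      ext x
      simp only [mem_inter_iff, mem_Ioo, mem_ofPred_eq, abs_lt]
      constructor
      · rintro ⟨a, b⟩
        exact ⟨⟨by linarith, b⟩, by linarith, by linarith⟩
      · rintro ⟨⟨a, b⟩, c, d⟩
        exact ⟨by linarith, b⟩
  have hAB : ∀ ε ∈ Ico 0 π, A ε = ∫ x in (t + x₀ - ε)..(t + x₀ + ε), F x := by
    intro ε hε
    rcases hε.1.eq_or_lt with rfl | h0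
    · rw [hAint 0 le_rfl hpi]
      have : ∀ x, ¬ |x - x₀| < 0 := fun x => (abs_nonneg _).not_gt
      simp [this]
    · rw [hAint ε hε.1 hε.2, ← hu.integral_arc ht (by
        rcases hx₀ with rfl | rfl
        · exact Or.inl (add_zero _)
        · exact Or.inr rfl) h0 hε.2]
      refine integral_congr_ae ?_
      filter_upwards [hae', ae_restrict_mem measurableSet_Ioo] with x h1 h2
      have : t + x - (t + x₀) = x - x₀ := by ring
      rw [h1, arc_of_abs_le hε.1 hε.2.le, this]
      rw [this, abs_le]
      constructor <;> linarith [h2.1, h2.2, hx₀'.1, hx₀'.2]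
  have hAB' : (fun ε => ∫ x in (t + x₀ - ε)..(t + x₀ + ε), F x) =ᶠ[𝓝[≥] 0] A := by
    filter_upwards [Ico_mem_nhdsGE hpi] with ε hε
    exact (hAB ε hε).symm
  have h1 := hB.hasDerivWithinAt (s := Ici 0)
  have h2 := (hA.hasDerivWithinAt (s := Ici 0)).congr_of_eventuallyEq hAB'
    (hAB 0 ⟨le_rfl, hpi⟩).symm
  rw [← hGb, ← hHG x₀ hx₀']
  exact ((uniqueDiffOn_Ici (0 : ℝ)) 0 self_mem_Ici).eq_deriv _ h2 h1

/-! ### A covering criterion for observability -/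

lemma sq_norm_L2 (f : L2) : ‖f‖ ^ 2 = ∫ x in Ioo 0 π, f x ^ 2 := by
  rw [← real_inner_self_eq_norm_sq, L2.inner_def]
  refine integral_congr_ae (Eventually.of_forall fun x => ?_)
  simp [sq]

lemma integrable_sq_L2 (f : L2) : Integrable (fun x => f x ^ 2) spaceMeasure :=
  (Lp.memLp f).integrable_sq

/-- The energy is the squared norm of the Riemann invariant over one period. -/
lemma ofReal_energy (u₀ : H10) (u₁ : L2) :
    ENNReal.ofReal (energy u₀ u₁) = ∫⁻ x in Ioo 0 π,
      (ENNReal.ofReal (riemann u₀.dx u₁ x ^ 2)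
        + ENNReal.ofReal (riemann u₀.dx u₁ (x + π) ^ 2)) := by
  have hm : Measurable fun x => ENNReal.ofReal (riemann u₀.dx u₁ x ^ 2) :=
    ((measurable_riemann _ _).pow_const 2).ennreal_ofReal
  have hrefl : ∫⁻ x in Ioo 0 π, ENNReal.ofReal (riemann u₀.dx u₁ (x + π) ^ 2)
      = ∫⁻ x in Ioo 0 π, ENNReal.ofReal (riemann u₀.dx u₁ (-x) ^ 2) := by
    have hmn : Measurable fun x => ENNReal.ofReal (riemann u₀.dx u₁ (-x) ^ 2) :=
      hm.comp measurable_neg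
    have hpre : (fun x => π - x) ⁻¹' Ioo 0 π = Ioo 0 π := by simp
    rw [← (Measure.measurePreserving_sub_left volume π).setLIntegral_comp_preimage
      measurableSet_Ioo hmn, hpre]
    refine lintegral_congr fun x => ?_
    rw [← riemann_periodic _ _ (-(π - x))]
    ring_nf
  rw [lintegral_add_left hm, hrefl, ← lintegral_add_left hm]
  have hpt : ∀ x ∈ Ioo 0 π, ENNReal.ofReal (riemann u₀.dx u₁ x ^ 2)
      + ENNReal.ofReal (riemann u₀.dx u₁ (-x) ^ 2)
      = ENNReal.ofReal ((u₀.dx x ^ 2 + u₁ x ^ 2) / 2) := fun x hx => by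
    rw [riemann_of_pos _ _ hx, riemann_neg _ _ hx, ← ENNReal.ofReal_add (sq_nonneg _) (sq_nonneg _)]
    ring_nf
  have hint : Integrable (fun x => (u₀.dx x ^ 2 + u₁ x ^ 2) / 2) spaceMeasure :=
    ((integrable_sq_L2 _).add (integrable_sq_L2 _)).div_const 2
  rw [setLIntegral_congr_fun measurableSet_Ioo hpt, ← ofReal_integral_eq_lintegral_ofReal hint
    (Eventually.of_forall fun x => by positivity)]
  rw [integral_div, integral_add (integrable_sq_L2 _) (integrable_sq_L2 _), energy,
    sq_norm_L2, sq_norm_L2]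
  ring_nf

lemma disjoint_Ioo_nat_mul {a : ℝ} (ha : 0 < a) :
    Pairwise (Function.onFun Disjoint fun k : ℕ => Ioo (k * a) ((k + 1) * a)) := by
  have key : ∀ k l : ℕ, k < l →
      Disjoint (Ioo (k * a) ((k + 1) * a)) (Ioo (l * a) ((l + 1) * a)) := by
    intro k l hkl
    rw [Set.disjoint_left]
    intro x hx hx'
    have : (k + 1 : ℝ) ≤ l := by exact_mod_cast hkl
    have : (k + 1) * a ≤ l * a := by gcongr
    linarith [hx.2, hx'.1]
  intro k l hkl
  rcases hkl.lt_or_gt with h | h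
  · exact key k l h
  · exact (key l k h).symm

lemma floor_of_mem_constantRate {T₀ t : ℝ} (hT₀ : 0 < T₀) {k : ℕ} (ht : t ∈ constantRate T₀ k) :
    ⌊t / T₀⌋₊ = k := by
  rw [Nat.floor_eq_iff (div_nonneg (le_trans (by positivity) ht.1.le) hT₀.le)]
  exact ⟨by rw [le_div_iff₀ hT₀]; exact ht.1.le, by rw [div_lt_iff₀ hT₀]; exact ht.2⟩

lemma endpoint_mem (k : ℕ) : endpoint k ∈ ({0, π} : Set ℝ) := by
  rw [endpoint]
  split_ifs <;> simp

lemma periodic_add_nat_mul_pi {α : Type*} {H : ℝ → α} (hH : Function.Periodic H (2 * π)) (s : ℝ)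
    (p : ℕ) : H (s + p * π) = if Even p then H s else H (s + π) := by
  split_ifs with h
  · obtain ⟨r, rfl⟩ := h
    rw [← hH.nat_mul r s]
    push_cast
    ring_nf
  · obtain ⟨r, rfl⟩ := Nat.not_even_iff_odd.1 h
    rw [← hH.nat_mul r (s + π)]
    push_cast
    ring_nf

/-- The point of the circle observed at time `s + i π` during the `n`-th interval is `s` or
`s + π`, according to the parity of `i + n`. -/
lemma periodic_add_endpoint {α : Type*} {H : ℝ → α} (hH : Function.Periodic H (2 * π)) (s : ℝ)
    (i n : ℕ) : H (s + i * π + endpoint n) = if Even (i + n) then H s else H (s + π) := by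
  rw [endpoint]
  split_ifs with h1 h2 h2
  · rw [add_zero, periodic_add_nat_mul_pi hH, if_pos]
    rwa [Nat.even_add, iff_true_right h1] at h2
  · rw [add_zero, periodic_add_nat_mul_pi hH, if_neg]
    rwa [Nat.even_add, iff_true_right h1] at h2
  · rw [show s + i * π + π = s + ((i + 1 : ℕ) : ℝ) * π by push_cast; ring,
      periodic_add_nat_mul_pi hH, if_pos]
    rw [Nat.even_add] at h2
    rw [Nat.even_add_one]
    tauto
  · rw [show s + i * π + π = s + ((i + 1 : ℕ) : ℝ) * π by push_cast; ring,
      periodic_add_nat_mul_pi hH, if_neg]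
    rw [Nat.even_add] at h2
    rw [Nat.even_add_one]
    tauto

lemma measurable_endpoint_floor (T₀ : ℝ) : Measurable fun t : ℝ => endpoint ⌊t / T₀⌋₊ :=
  (measurable_from_nat (f := endpoint)).comp
    (Nat.measurable_floor.comp (measurable_id.div_const T₀))

/-- For `s ∈ (0, π)`, each of the times `s + i π` observes one of the two points `s`, `s + π` of the
circle.  If the index of the exchange interval changes by an even number between `s + i π` and
`s + (i + 1) π`, these two times observe different points. -/
lemma lintegral_period_le {T₀ T : ℝ} (hT₀ : 0 < T₀)
    (hc : ∀ s ∈ Ioo 0 π, ∃ i : ℕ, s + (i + 1) * π < T ∧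
      Even (⌊(s + (i + 1) * π) / T₀⌋ - ⌊(s + i * π) / T₀⌋))
    {n : ℕ} (hn : T ≤ (n + 1) * T₀) {H : ℝ → ENNReal} (hm : Measurable H)
    (hH : Function.Periodic H (2 * π)) :
    ∫⁻ s in Ioo 0 π, (H s + H (s + π)) ≤
      ∑ k ∈ Finset.range (n + 1), ∫⁻ t in constantRate T₀ k ∩ Ioo 0 T, H (t + endpoint k) := by
  have hpi := Real.pi_pos
  set K : ℝ → ENNReal := fun t => H (t + endpoint ⌊t / T₀⌋₊)
  have hK : Measurable K := hm.comp (measurable_id.add (measurable_endpoint_floor T₀))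
  set K' : ℝ → ENNReal := (Ioo 0 T).indicator K
  have hK' : Measurable K' := hK.indicator measurableSet_Ioo
  obtain ⟨M, hM⟩ := exists_nat_ge (T / π)
  rw [div_le_iff₀ hpi] at hM
  have hpt : ∀ s ∈ Ioo 0 π, H s + H (s + π) ≤ ∑ i ∈ Finset.range M, K' (s + i * π) := by
    intro s hs
    obtain ⟨i, hi, he⟩ := hc s hs
    have hp : ∀ l : ℕ, 0 < s + l * π := fun l => by have := hs.1; positivity
    have hiM : i + 1 < M := by
      have : ((i + 1 : ℕ) : ℝ) * π < M * π := by push_cast; linarith [hs.1]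
      exact_mod_cast lt_of_mul_lt_mul_right this hpi.le
    have hval : ∀ l : ℕ, s + l * π < T → K' (s + l * π)
        = if Even (l + ⌊(s + l * π) / T₀⌋₊) then H s else H (s + π) := fun l hl => by
      rw [← periodic_add_endpoint hH]
      exact indicator_of_mem (s := Ioo 0 T) ⟨hp l, hl⟩ K
    have hsub : ({i, i + 1} : Finset ℕ) ⊆ Finset.range M := by
      intro l hl
      simp only [Finset.mem_insert, Finset.mem_singleton] at hl
      rw [Finset.mem_range]
      omega
    refine le_trans ?_ (Finset.sum_le_sum_of_subset hsub)
    have hi' : s + ((i + 1 : ℕ) : ℝ) * π < T := by exact_mod_cast hi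
    rw [Finset.sum_pair (by omega), hval i (by push_cast at hi'; linarith), hval (i + 1) hi']
    have hfl : ∀ l : ℕ, ((⌊(s + l * π) / T₀⌋₊ : ℕ) : ℤ) = ⌊(s + l * π) / T₀⌋ := fun l =>
      Int.natCast_floor_eq_floor (div_nonneg (hp l).le hT₀.le)
    have he' : Even ((⌊(s + ((i + 1 : ℕ) : ℝ) * π) / T₀⌋₊ : ℤ) - (⌊(s + i * π) / T₀⌋₊ : ℤ)) := by
      rw [hfl, hfl]
      exact_mod_cast he
    rw [Int.even_sub, Int.even_coe_nat, Int.even_coe_nat] at he'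
    have h2 : Even (i + 1 + ⌊(s + ((i + 1 : ℕ) : ℝ) * π) / T₀⌋₊)
        ↔ ¬ Even (i + ⌊(s + i * π) / T₀⌋₊) := by
      rw [Nat.even_add, he', Nat.even_add_one, Nat.even_add]
      tauto
    by_cases h1 : Even (i + ⌊(s + i * π) / T₀⌋₊)
    · rw [if_pos h1, if_neg (by rw [h2]; exact not_not.2 h1)]
    · rw [if_neg h1, if_pos (h2.2 h1), add_comm]
  calc ∫⁻ s in Ioo 0 π, (H s + H (s + π))
      ≤ ∫⁻ s in Ioo 0 π, ∑ i ∈ Finset.range M, K' (s + i * π) :=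
        setLIntegral_mono' measurableSet_Ioo hpt
    _ = ∑ i ∈ Finset.range M, ∫⁻ s in Ioo 0 π, K' (s + i * π) :=
        lintegral_finsetSum _ fun i _ => hK'.comp (measurable_id.add_const _)
    _ = ∑ i ∈ Finset.range M, ∫⁻ t in Ioo (i * π) ((i + 1) * π), K' t := by
        refine Finset.sum_congr rfl fun i _ => ?_
        have hpre : (fun x => x + i * π) ⁻¹' Ioo (i * π) ((i + 1) * π) = Ioo 0 π := by
          rw [preimage_add_const_Ioo]
          congr 1 <;> ring
        rw [← (measurePreserving_add_right volume (i * π)).setLIntegral_comp_preimage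
          measurableSet_Ioo hK', hpre]
    _ = ∫⁻ t in ⋃ i ∈ Finset.range M, Ioo (i * π) ((i + 1) * π), K' t :=
        (lintegral_biUnion_finset ((disjoint_Ioo_nat_mul hpi).set_pairwise _)
          (fun _ _ => measurableSet_Ioo) _).symm
    _ ≤ ∫⁻ t, K' t := setLIntegral_le_lintegral _ _
    _ = ∫⁻ t in Ioo 0 T, K t := lintegral_indicator measurableSet_Ioo _
    _ ≤ ∫⁻ t in (⋃ k ∈ Finset.range (n + 1), constantRate T₀ k ∩ Ioo 0 T)
          ∪ range (fun k : ℕ => (k : ℝ) * T₀), K t := by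
        refine lintegral_mono_set fun t ht => ?_
        have h0 : 0 ≤ t / T₀ := div_nonneg ht.1.le hT₀.le
        have hle := Nat.floor_le h0
        have hlt := Nat.lt_floor_add_one (t / T₀)
        rw [le_div_iff₀ hT₀] at hle
        rw [div_lt_iff₀ hT₀] at hlt
        rcases hle.eq_or_lt with h | h
        · exact Or.inr ⟨_, h⟩
        · refine Or.inl (mem_iUnion₂.2 ⟨⌊t / T₀⌋₊, ?_, ⟨h, hlt⟩, ht⟩)
          rw [Finset.mem_range]
          have : (⌊t / T₀⌋₊ : ℝ) * T₀ < ((n + 1 : ℕ) : ℝ) * T₀ := by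
            push_cast
            linarith [ht.2]
          exact_mod_cast lt_of_mul_lt_mul_right this hT₀.le
    _ ≤ (∫⁻ t in ⋃ k ∈ Finset.range (n + 1), constantRate T₀ k ∩ Ioo 0 T, K t)
          + ∫⁻ t in range (fun k : ℕ => (k : ℝ) * T₀), K t := lintegral_union_le _ _ _
    _ = ∑ k ∈ Finset.range (n + 1), ∫⁻ t in constantRate T₀ k ∩ Ioo 0 T, K t := by
        rw [setLIntegral_measure_zero _ _ ((countable_range _).measure_zero _), add_zero]
        refine lintegral_biUnion_finset (Pairwise.set_pairwise ?_ _)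
          (fun _ _ => measurableSet_Ioo.inter measurableSet_Ioo) _
        exact fun k l hkl => (disjoint_Ioo_nat_mul hT₀ hkl).mono inter_subset_left inter_subset_left
    _ = _ := by
        refine Finset.sum_congr rfl fun k _ => ?_
        refine setLIntegral_congr_fun (measurableSet_Ioo.inter measurableSet_Ioo) fun t ht => ?_
        simp only [K, floor_of_mem_constantRate hT₀ ht.1]

/-- The observability inequality for strong solutions. -/
lemma ofReal_energy_le_of_isStrongSolution {T₀ T : ℝ} (hT₀ : 0 < T₀)
    (hc : ∀ s ∈ Ioo 0 π, ∃ i : ℕ, s + (i + 1) * π < T ∧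
      Even (⌊(s + (i + 1) * π) / T₀⌋ - ⌊(s + i * π) / T₀⌋))
    {n : ℕ} (hn : T ≤ (n + 1) * T₀) {u₀ : H10} {u₁ : L2} {u : ℝ → H10} {v : ℝ → L2}
    (hu : IsStrongSolution u₀ u₁ u v) {G : ℝ → ℝ → ℝ} (hG : IsClassicalTrace u G) :
    ENNReal.ofReal (4 * energy u₀ u₁) ≤ ∑ k ∈ Finset.range (n + 1),
      ∫⁻ t in constantRate T₀ k ∩ Ioo 0 T, ENNReal.ofReal (G (endpoint k) t ^ 2) := by
  have hm : Measurable fun x => ENNReal.ofReal (riemann u₀.dx u₁ x ^ 2) :=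
    ((measurable_riemann _ _).pow_const 2).ennreal_ofReal
  have hper : Function.Periodic (fun x => ENNReal.ofReal (riemann u₀.dx u₁ x ^ 2)) (2 * π) :=
    fun x => by simp only [riemann_periodic _ _ x]
  have h := lintegral_period_le hT₀ hc hn hm hper
  rw [← ofReal_energy] at h
  rw [ENNReal.ofReal_mul (by norm_num)]
  refine (mul_le_mul_right h _).trans_eq ?_
  rw [Finset.mul_sum]
  refine Finset.sum_congr rfl fun k _ => ?_
  rw [← lintegral_const_mul' _ _ ENNReal.ofReal_ne_top]
  refine lintegral_congr_ae ?_
  filter_upwards [ae_restrict_mem (measurableSet_Ioo.inter measurableSet_Ioo),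
    ae_restrict_of_ae (hu.trace_eq (endpoint_mem k))] with t ht htr
  have h0 : 0 ≤ t := ht.2.1.le
  rw [htr h0 _ (hG t h0 _ (endpoint_mem k)), ← ENNReal.ofReal_mul (by norm_num)]
  congr 1
  ring

lemma lintegral_ofReal_sq (f : ℝ → ℝ) (μ : Measure ℝ) :
    ∫⁻ t, ENNReal.ofReal (f t ^ 2) ∂μ = eLpNorm f 2 μ ^ 2 := by
  have h := eLpNorm_nnreal_pow_eq_lintegral (f := f) (μ := μ) (p := 2) two_ne_zero
  simp only [NNReal.coe_ofNat, ENNReal.coe_ofNat, ENNReal.rpow_ofNat] at h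
  rw [h]
  refine lintegral_congr fun t => ?_
  rw [Real.enorm_eq_ofReal_abs, ← ENNReal.ofReal_pow (abs_nonneg _), sq_abs]

/-- Observability from the covering criterion, by density of strong solutions. -/
lemma observableInTime_of_cover {T₀ T : ℝ} (hT₀ : 0 < T₀) (hT : 0 < T)
    (hc : ∀ s ∈ Ioo 0 π, ∃ i : ℕ, s + (i + 1) * π < T ∧
      Even (⌊(s + (i + 1) * π) / T₀⌋ - ⌊(s + i * π) / T₀⌋)) :
    ObservableInTime (constantRate T₀) T := by
  obtain ⟨n, hn⟩ := exists_nat_ge (T / T₀)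
  rw [div_le_iff₀ hT₀] at hn
  replace hn : T ≤ (n + 1) * T₀ := hn.trans (by gcongr; linarith)
  -- the constant is `2` because `G²` is bounded by `2 (G - g)² + 2 g²` in the limit
  refine ⟨hT, n, 2, two_pos, fun u₀ u₁ u v _ g hg => ?_⟩
  obtain ⟨hgm, a₀, a₁, us, vs, G, hs, hG, ha₀, ha₁, hlim⟩ := hg
  set S : ℕ → Set ℝ := fun k => constantRate T₀ k ∩ Ioo 0 T
  set μ : ℕ → Measure ℝ := fun k => volume.restrict (S k)
  have hμ : ∀ k, μ k ≤ volume.restrict (Ioo 0 T) := fun k =>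
    Measure.restrict_mono inter_subset_right le_rfl
  set δ : ℕ → ℕ → ENNReal := fun m k =>
    eLpNorm (fun t => G m (endpoint k) t - g (endpoint k) t) 2 (volume.restrict (Ioo 0 T)) ^ 2
  have hδ : ∀ k, Tendsto (fun m => δ m k) atTop (𝓝 0) := fun k => by
    have := ENNReal.Tendsto.pow (n := 2) (hlim _ (endpoint_mem k))
    simpa using this
  have hmem : ∀ k, MemLp (g (endpoint k)) 2 (μ k) := fun k =>
    (hgm _ (endpoint_mem k)).mono_measure (hμ k)
  have hbound : ∀ m, ENNReal.ofReal (4 * energy (a₀ m) (a₁ m)) ≤ ∑ k ∈ Finset.range (n + 1),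
      (2 * δ m k + 2 * ∫⁻ t, ENNReal.ofReal (g (endpoint k) t ^ 2) ∂μ k) := by
    intro m
    refine (ofReal_energy_le_of_isStrongSolution hT₀ hc hn (hs m) (hG m)).trans ?_
    refine Finset.sum_le_sum fun k _ => ?_
    have hmeas : AEMeasurable (fun t => 2 * ENNReal.ofReal (g (endpoint k) t ^ 2)) (μ k) :=
      (((hmem k).aestronglyMeasurable.aemeasurable.pow_const 2).ennreal_ofReal).const_mul 2
    calc ∫⁻ t, ENNReal.ofReal (G m (endpoint k) t ^ 2) ∂μ k
        ≤ ∫⁻ t, (2 * ENNReal.ofReal ((G m (endpoint k) t - g (endpoint k) t) ^ 2)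
            + 2 * ENNReal.ofReal (g (endpoint k) t ^ 2)) ∂μ k := by
          refine lintegral_mono fun t => ?_
          rw [← ENNReal.ofReal_ofNat 2, ← ENNReal.ofReal_mul zero_le_two,
            ← ENNReal.ofReal_mul zero_le_two, ← ENNReal.ofReal_add (by positivity) (by positivity)]
          refine ENNReal.ofReal_le_ofReal ?_
          nlinarith [sq_nonneg (G m (endpoint k) t - g (endpoint k) t - g (endpoint k) t)]
      _ = 2 * (∫⁻ t, ENNReal.ofReal ((G m (endpoint k) t - g (endpoint k) t) ^ 2) ∂μ k)
            + 2 * ∫⁻ t, ENNReal.ofReal (g (endpoint k) t ^ 2) ∂μ k := by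
          rw [lintegral_add_right' _ hmeas, lintegral_const_mul' _ _ ENNReal.ofNat_ne_top,
            lintegral_const_mul' _ _ ENNReal.ofNat_ne_top]
      _ ≤ 2 * δ m k + 2 * ∫⁻ t, ENNReal.ofReal (g (endpoint k) t ^ 2) ∂μ k := by
          refine add_le_add (mul_le_mul_right ?_ 2) le_rfl
          rw [lintegral_ofReal_sq (fun t => G m (endpoint k) t - g (endpoint k) t)]
          exact pow_le_pow_left₀ zero_le (eLpNorm_mono_measure _ (hμ k)) 2
  have hE : Tendsto (fun m => ENNReal.ofReal (4 * energy (a₀ m) (a₁ m))) atTop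
      (𝓝 (ENNReal.ofReal (4 * energy u₀ u₁))) := by
    have h1 : Tendsto (fun m => (a₀ m).dx) atTop (𝓝 u₀.dx) :=
      ((continuous_snd.comp continuous_subtype_val).tendsto u₀).comp ha₀
    exact ENNReal.tendsto_ofReal
      ((((h1.norm.pow 2).add (ha₁.norm.pow 2)).const_mul _).const_mul _)
  have hR : Tendsto (fun m => ∑ k ∈ Finset.range (n + 1),
      (2 * δ m k + 2 * ∫⁻ t, ENNReal.ofReal (g (endpoint k) t ^ 2) ∂μ k)) atTop
      (𝓝 (∑ k ∈ Finset.range (n + 1),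
        (2 * 0 + 2 * ∫⁻ t, ENNReal.ofReal (g (endpoint k) t ^ 2) ∂μ k))) :=
    tendsto_finsetSum _ fun k _ =>
      (ENNReal.Tendsto.const_mul (hδ k) (Or.inr ENNReal.ofNat_ne_top)).add tendsto_const_nhds
  have hfin := le_of_tendsto_of_tendsto' hE hR hbound
  have hval : ∀ k, 2 * 0 + 2 * ∫⁻ t, ENNReal.ofReal (g (endpoint k) t ^ 2) ∂μ k
      = ENNReal.ofReal (2 * ∫ t in S k, |g (endpoint k) t| ^ 2) := fun k => by
    simp only [sq_abs]
    rw [mul_zero, zero_add, ENNReal.ofReal_mul zero_le_two, ENNReal.ofReal_ofNat,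
      ofReal_integral_eq_lintegral_ofReal (hmem k).integrable_sq
      (Eventually.of_forall fun t => sq_nonneg _)]
  simp only [hval] at hfin
  have hnn : ∀ k, 0 ≤ ∫ t in S k, |g (endpoint k) t| ^ 2 := fun k =>
    integral_nonneg fun t => by positivity
  rw [← ENNReal.ofReal_sum_of_nonneg fun k _ => mul_nonneg zero_le_two (hnn k),
    ENNReal.ofReal_le_ofReal_iff (Finset.sum_nonneg fun k _ => mul_nonneg zero_le_two (hnn k)),
    ← Finset.mul_sum] at hfin
  linarith

/-! ### A criterion for the failure of observability -/

lemma eq_zero_of_norm_contL2_eq_zero {f : ℝ → ℝ} (hf : Continuous f) (h : ‖contL2 f hf‖ = 0) {x : ℝ}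
    (hx : x ∈ Ioo 0 π) : f x = 0 := by
  have h0 : f =ᵐ[spaceMeasure] fun _ => 0 := by
    refine (coeFn_contL2 hf).symm.trans ?_
    rw [norm_eq_zero.1 h]
    exact Lp.coeFn_zero ℝ 2 spaceMeasure
  exact Measure.eqOn_open_of_ae_eq h0 isOpen_Ioo hf.continuousOn continuousOn_const hx

lemma exists_int_of_cos_lt {ε y : ℝ} (h0 : 0 ≤ ε) (hπ : ε ≤ π) (h : Real.cos ε < Real.cos y) :
    ∃ r : ℤ, |y - r * (2 * π)| < ε := by
  obtain ⟨r, hr, -⟩ := existsUnique_sub_zsmul_mem_Ico Real.two_pi_pos y (-π)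
  rw [zsmul_eq_mul] at hr
  refine ⟨r, ?_⟩
  have habs : |y - r * (2 * π)| ≤ π := abs_le.2 ⟨hr.1, by linarith [hr.2]⟩
  rw [← Real.strictAntiOn_cos.lt_iff_gt ⟨h0, hπ⟩ ⟨abs_nonneg _, habs⟩, Real.cos_abs,
    Real.cos_sub_int_mul_two_pi]
  exact h

lemma smoothArc_eq_zero {c ε : ℝ} {n : ℕ} {x : ℝ} (h : Real.cos (x - c) ≤ Real.cos ε) :
    smoothArc c ε n x = 0 :=
  Real.smoothTransition.zero_of_nonpos
    (mul_nonpos_of_nonneg_of_nonpos n.cast_nonneg (by linarith))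

/-- The derivative of `smoothArc` is supported in the open arc: off the arc the function attains
its minimum. -/
lemma cos_lt_of_deriv_smoothArc_ne_zero {c ε : ℝ} {n : ℕ} {x : ℝ}
    (h : deriv (smoothArc c ε n) x ≠ 0) : Real.cos ε < Real.cos (x - c) := by
  by_contra hle
  refine h (IsLocalMin.deriv_eq_zero (Eventually.of_forall fun y => ?_))
  rw [smoothArc_eq_zero (not_lt.1 hle)]
  exact Real.smoothTransition.nonneg _

lemma even_add_floor_sub {T₀ T s : ℝ} {m : ℤ} (hm : ⌊s / T₀⌋ = m)
    (h : ∀ i : ℕ, s + (i + 1) * π < T →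
      Odd (⌊(s + (i + 1) * π) / T₀⌋ - ⌊(s + i * π) / T₀⌋)) (i : ℕ) (hi : s + i * π < T) :
    Even ((i : ℤ) + ⌊(s + i * π) / T₀⌋ - m) := by
  induction i with
  | zero => simp [hm]
  | succ i ih =>
    push_cast at hi ⊢
    have h1 := h i hi
    have h2 := ih (by linarith [Real.pi_pos])
    rw [Int.even_iff] at *
    rw [Int.odd_iff] at h1
    omega

lemma SmoothPeriodic.isClassicalTrace {θ : ℝ → ℝ} (h : SmoothPeriodic θ) :
    IsClassicalTrace h.wave (fun x t => SmoothPeriodic.sumFun (_root_.deriv θ) t x) :=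
  fun t _ _ _ =>
  ⟨_, (h.deriv.continuous_sumFun t).continuousOn,
    coeFn_contL2 (h.deriv.continuous_sumFun t), rfl⟩

lemma SmoothPeriodic.isBoundaryTrace {θ : ℝ → ℝ} (h : SmoothPeriodic θ) (T : ℝ) :
    IsBoundaryTrace (h.wave 0) (h.deriv.diffWave 0) T
      (fun x t => SmoothPeriodic.sumFun (_root_.deriv θ) t x) := by
  refine ⟨fun x _ => ?_, fun _ => h.wave 0, fun _ => h.deriv.diffWave 0, fun _ => h.wave,
    fun _ => h.deriv.diffWave, fun _ => _, fun _ => h.isStrongSolution,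
    fun _ => h.isClassicalTrace, tendsto_const_nhds, tendsto_const_nhds, fun x _ => ?_⟩
  · obtain ⟨C, -, hC⟩ := h.deriv.exists_bound
    have hcont : Continuous fun t => SmoothPeriodic.sumFun (_root_.deriv θ) t x :=
      (h.deriv.continuous.comp (by fun_prop)).add (h.deriv.continuous.comp (by fun_prop))
    refine MemLp.of_bound hcont.aestronglyMeasurable (C + C) (Eventually.of_forall fun t => ?_)
    exact (abs_add_le _ _).trans (add_le_add (hC _) (hC _))
  · simp

lemma SmoothPeriodic.sumFun_endpoint {θ : ℝ → ℝ} (h : SmoothPeriodic θ) (k : ℕ) (t : ℝ) :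
    SmoothPeriodic.sumFun θ t (endpoint k) = 2 * θ (t + endpoint k) := by
  have : θ (t - endpoint k) = θ (t + endpoint k) := by
    rw [endpoint]
    split_ifs
    · simp
    · rw [← h.periodic (t - π)]
      ring_nf
  rw [SmoothPeriodic.sumFun, this, two_mul]

/-- If the characteristics through all `s` in an open interval miss one of the two points `s`,
`s + π` of the circle before time `T`, then a solution concentrated near the missed points is not
observed. -/
lemma not_observableInTime {T₀ T s₁ s₂ : ℝ} {m : ℤ} (hT₀ : 0 < T₀) (hs : s₁ < s₂) (hs₁ : 0 ≤ s₁)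
    (hs₂ : s₂ ≤ π) (hm : ∀ s ∈ Ioo s₁ s₂, ⌊s / T₀⌋ = m)
    (h : ∀ s ∈ Ioo s₁ s₂, ∀ i : ℕ, s + (i + 1) * π < T →
      Odd (⌊(s + (i + 1) * π) / T₀⌋ - ⌊(s + i * π) / T₀⌋)) :
    ¬ ObservableInTime (constantRate T₀) T := by
  rintro ⟨-, n, C, hC, hobs⟩
  have hpi := Real.pi_pos
  -- the observed point is `s` or `s + π`, according to the parity of `m`; `c` is the other one
  set c : ℝ := (s₁ + s₂) / 2 + (if Even m then π else 0) with hc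
  set ε : ℝ := (s₂ - s₁) / 2 with hε
  have hε0 : 0 < ε := by linarith
  have hεπ : ε ≤ π := by linarith
  set θ := smoothArc c ε 1
  have hθ : SmoothPeriodic θ := smoothPeriodic_smoothArc c ε 1
  have hvanish : ∀ k : ℕ, ∀ t ∈ constantRate T₀ k ∩ Ioo 0 T, deriv θ (t + endpoint k) = 0 := by
    intro k t ht
    by_contra hne
    obtain ⟨r, hr⟩ := exists_int_of_cos_lt hε0.le hεπ (cos_lt_of_deriv_smoothArc_ne_zero hne)
    rw [abs_lt] at hr
    set q : ℤ := 2 * r + (if Even m then 1 else 0) - (if Even k then 0 else 1) with hq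
    set s : ℝ := t - q * π with hsdef
    have hs' : s = t + endpoint k - (if Even m then π else 0) - r * (2 * π) := by
      rw [hsdef, hq, endpoint]
      split_ifs <;> push_cast <;> ring
    have hsmem : s ∈ Ioo s₁ s₂ := by
      rw [hs']
      constructor <;> linarith [hr.1, hr.2]
    have hq0 : 0 ≤ q := by
      by_contra hneg
      have : (q : ℝ) ≤ -1 := by exact_mod_cast (by omega : q ≤ -1)
      have : (q : ℝ) * π ≤ -1 * π := by gcongr
      linarith [ht.2.1, hsmem.2]
    obtain ⟨i, hi⟩ := Int.eq_ofNat_of_zero_le hq0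
    have hti : s + i * π = t := by
      rw [hsdef, hi]
      push_cast
      ring
    have hev := even_add_floor_sub (hm s hsmem) (h s hsmem) i (by rw [hti]; exact ht.2.2)
    rw [hti, ← Int.natCast_floor_eq_floor (div_nonneg ht.2.1.le hT₀.le),
      floor_of_mem_constantRate hT₀ ht.1, ← hi, hq] at hev
    split_ifs at hev with h1 h2 h2 <;> grind
  have hle := hobs _ _ _ _ hθ.isStrongSolution.toIsWeakSolution _ (hθ.isBoundaryTrace T)
  rw [Finset.sum_eq_zero fun k _ => ?_] at hle
  swap
  · rw [setIntegral_congr_fun (g := fun _ => (0 : ℝ))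
      (show MeasurableSet (constantRate T₀ k ∩ Ioo 0 T) from
        measurableSet_Ioo.inter measurableSet_Ioo)]
    · simp
    · intro t ht
      simp only [hθ.deriv.sumFun_endpoint, hvanish k t ht]
      simp
  have hE : energy (hθ.wave 0) (hθ.deriv.diffWave 0) ≤ 0 := by
    by_contra hpos
    exact (mul_pos hC (not_le.1 hpos)).not_ge hle
  rw [energy] at hE
  have hn1 : ‖(hθ.wave 0).dx‖ = 0 := by
    nlinarith [sq_nonneg ‖(hθ.wave 0).dx‖, sq_nonneg ‖hθ.deriv.diffWave 0‖]
  have hn2 : ‖hθ.deriv.diffWave 0‖ = 0 := by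
    nlinarith [sq_nonneg ‖(hθ.wave 0).dx‖, sq_nonneg ‖hθ.deriv.diffWave 0‖]
  have hzero : ∀ x ∈ Ioo 0 π, deriv θ x = 0 ∧ deriv θ (-x) = 0 := by
    intro x hx
    have e1 := eq_zero_of_norm_contL2_eq_zero (hθ.deriv.continuous_sumFun 0) hn1 hx
    have e2 := eq_zero_of_norm_contL2_eq_zero (hθ.deriv.continuous_diffFun 0) hn2 hx
    simp only [SmoothPeriodic.sumFun, SmoothPeriodic.diffFun, zero_add, zero_sub] at e1 e2
    constructor <;> linarith
  obtain ⟨ξ, hξ, hξ'⟩ := exists_deriv_eq_slope θ (show c - ε < c by linarith)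
    hθ.continuous.continuousOn hθ.differentiable.differentiableOn
  have hval : θ (c - ε) = 0 := smoothArc_eq_zero (by rw [sub_sub_cancel_left, Real.cos_neg])
  have hcpos : 0 < θ c := by
    refine Real.smoothTransition.pos_of_pos ?_
    have : Real.cos ε < Real.cos 0 :=
      Real.strictAntiOn_cos ⟨le_rfl, hpi.le⟩ ⟨hε0.le, hεπ⟩ hε0
    simpa using this
  have hne : deriv θ ξ ≠ 0 := by
    rw [hξ', hval, sub_zero]
    exact (div_pos hcpos (by linarith)).ne'
  split_ifs at hc with hpar
  · refine hne ?_
    rw [← hθ.deriv.periodic.sub_eq ξ, show ξ - 2 * π = -(2 * π - ξ) by ring]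
    exact (hzero _ ⟨by linarith [hξ.2], by linarith [hξ.1]⟩).2
  · exact hne (hzero ξ ⟨by linarith [hξ.1], by linarith [hξ.2]⟩).1

/-! ### The rotation by `π / T₀` and the optimal times -/

lemma floor_div_eq {T₀ t r : ℝ} {m : ℤ} (hT₀ : 0 < T₀) (h : t = (m + r) * T₀) (h0 : 0 ≤ r)
    (h1 : r < 1) : ⌊t / T₀⌋ = m := by
  rw [h, mul_div_cancel_right₀ _ hT₀.ne', Int.floor_eq_iff]
  constructor <;> linarith

lemma exists_floor_decomposition {T₀ s α : ℝ} {j : ℕ} (hT₀ : 0 < T₀) (hπ : π = (j + α) * T₀)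
    (hα1 : α < 1) (hs : s ∈ Ioo 0 π) :
    ∃ (n : ℤ) (y : ℝ), s = (n + y) * T₀ ∧ 0 ≤ y ∧ y < 1 ∧ n ≤ j ∧ n + y < j + α := by
  refine ⟨⌊s / T₀⌋, Int.fract (s / T₀), ?_, Int.fract_nonneg _, Int.fract_lt_one _, ?_, ?_⟩
  · rw [Int.floor_add_fract, div_mul_cancel₀ _ hT₀.ne']
  · have h1 : s / T₀ < j + α := by
      rw [div_lt_iff₀ hT₀, ← hπ]
      exact hs.2
    have h2 : (⌊s / T₀⌋ : ℝ) < ((j + 1 : ℤ) : ℝ) := by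
      push_cast
      linarith [Int.floor_le (s / T₀)]
    have h3 : ⌊s / T₀⌋ < (j : ℤ) + 1 := by exact_mod_cast h2
    omega
  · rw [Int.floor_add_fract, div_lt_iff₀ hT₀, ← hπ]
    exact hs.2

/-- If `j = ⌊π / T₀⌋` is odd, the parity is compensated when the rotation by the fractional part
`α` of `π / T₀` wraps around, which takes at most `M = ⌈1 / α⌉` steps. -/
lemma isOptimalTime_of_odd {T₀ α : ℝ} {j M : ℕ} (hT₀ : 0 < T₀) (hπ : π = (j + α) * T₀)
    (hα : 0 < α) (hα1 : α < 1) (hj : Odd j) (hM : 1 ≤ M * α) (hM' : (M - 1) * α < 1) :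
    IsOptimalTime (constantRate T₀) (π + T₀ * (j * M + 1)) := by
  have hpi := Real.pi_pos
  have hM1 : (1 : ℝ) ≤ M := by
    have : 1 ≤ M := by
      rcases Nat.eq_zero_or_pos M with rfl | h
      · norm_num at hM
      · exact h
    exact_mod_cast this
  refine ⟨observableInTime_of_cover hT₀ (by positivity) fun s hs => ?_, fun T' hT' => ?_⟩
  · obtain ⟨n, y, rfl, hy0, hy1, hnj, hny⟩ := exists_floor_decomposition hT₀ hπ hα1 hs
    classical
    have hex : ∃ r : ℕ, 1 ≤ y + r * α := ⟨M, by linarith⟩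
    obtain ⟨i, hi⟩ : ∃ i, Nat.find hex = i + 1 := by
      refine Nat.exists_eq_succ_of_ne_zero fun h0 => ?_
      have := Nat.find_spec hex
      rw [h0] at this
      norm_num at this
      linarith
    have hi1 : 1 ≤ y + (i + 1) * α := by
      have := Nat.find_spec hex
      rw [hi] at this
      exact_mod_cast this
    have hi0 : y + i * α < 1 := not_le.1 (Nat.find_min hex (by omega))
    have hiM : i + 1 ≤ M := hi ▸ Nat.find_min' hex (by linarith)
    refine ⟨i, ?_, ?_⟩
    · rcases hiM.eq_or_lt with h | h
      · have hMi : (M : ℝ) = i + 1 := by rw [← h]; push_cast; rfl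
        have hn : (n : ℝ) ≤ j := by exact_mod_cast hnj
        have : n + y + (i + 1) * (j + α) < j + α + (j * (i + 1) + 1) := by nlinarith
        calc (n + y) * T₀ + (i + 1) * π = (n + y + (i + 1) * (j + α)) * T₀ := by rw [hπ]; ring
          _ < (j + α + (j * (i + 1) + 1)) * T₀ := by gcongr
          _ = π + T₀ * (j * M + 1) := by rw [hπ, hMi]; ring
      · have hMi : (i : ℝ) + 2 ≤ M := by exact_mod_cast h
        have h1 : (i + 2) * (j + α) ≤ M * (j + α) := by gcongr
        have h2 : M * (j + α) ≤ j + α + (j * M + 1) := by nlinarith [(j.cast_nonneg : (0 : ℝ) ≤ j)]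
        calc (n + y) * T₀ + (i + 1) * π < π + (i + 1) * π := by linarith [hs.2]
          _ = ((i + 2) * (j + α)) * T₀ := by rw [hπ]; ring
          _ ≤ (j + α + (j * M + 1)) * T₀ := by gcongr; exact h1.trans h2
          _ = π + T₀ * (j * M + 1) := by rw [hπ]; ring
    · rw [floor_div_eq (m := n + (i + 1) * j + 1) (r := y + (i + 1) * α - 1) hT₀
          (by rw [hπ]; push_cast; ring) (by linarith) (by linarith),
        floor_div_eq (m := n + i * j) (r := y + i * α) hT₀ (by rw [hπ]; push_cast; ring)
          (by positivity) hi0]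
      have : n + (i + 1) * j + 1 - (n + i * j) = ((j + 1 : ℕ) : ℤ) := by push_cast; ring
      rw [this, Int.even_coe_nat]
      exact hj.add_one
  -- points just before `s₂` wrap around after exactly `M` steps
  · set s₂ : ℝ := (j + 1 - (M - 1) * α) * T₀ with hs₂
    have hT : π + T₀ * (j * M + 1) = s₂ + M * π := by rw [hs₂, hπ]; ring
    have hlow : j * T₀ < s₂ := by rw [hs₂]; gcongr; linarith
    refine not_observableInTime (s₁ := max (j * T₀) (T' - M * π)) (s₂ := s₂) (m := j) hT₀
      (max_lt hlow (by linarith)) (le_max_of_le_left (by positivity)) ?_ ?_ ?_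
    · rw [hs₂, hπ]
      gcongr
      linarith
    all_goals
      intro s hs
      have hs1 := (le_max_left _ _).trans_lt hs.1
      have hs1' := (le_max_right _ _).trans_lt hs.1
      obtain ⟨y, rfl⟩ : ∃ y, s = (j + y) * T₀ := ⟨s / T₀ - j, by field_simp; ring⟩
      have hy0 : 0 < y := by
        have := lt_of_mul_lt_mul_right hs1 hT₀.le
        linarith
      have hyM : y < 1 - (M - 1) * α := by
        have := lt_of_mul_lt_mul_right (hs.2.trans_eq hs₂) hT₀.le
        linarith
    · have : 0 ≤ (M - 1) * α := mul_nonneg (by linarith) hα.le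
      exact floor_div_eq (r := y) hT₀ (by push_cast; rfl) hy0.le (by linarith)
    · intro i hi
      have hiM : i + 1 < M := by
        have : ((i + 1 : ℕ) : ℝ) * π < M * π := by push_cast; linarith
        exact_mod_cast lt_of_mul_lt_mul_right this hpi.le
      have hiM' : (i : ℝ) + 1 ≤ M - 1 := by
        have : ((i + 1 + 1 : ℕ) : ℝ) ≤ M := by exact_mod_cast hiM
        push_cast at this
        linarith
      have h1 : (i + 1) * α ≤ (M - 1) * α := by gcongr
      rw [floor_div_eq (m := j + (i + 1) * j) (r := y + (i + 1) * α) hT₀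
          (by rw [hπ]; push_cast; ring) (by positivity) (by linarith),
        floor_div_eq (m := j + i * j) (r := y + i * α) hT₀ (by rw [hπ]; push_cast; ring)
          (by positivity) (by linarith)]
      have : (j : ℤ) + (i + 1) * j - (j + i * j) = (j : ℕ) := by ring
      rw [this]
      exact_mod_cast hj

/-- If `j = ⌊π / T₀⌋` is even, the parity is compensated when the rotation by `-β`, where
`β = 1 - α` and `α` is the fractional part of `π / T₀`, wraps around, which takes at most
`L = ⌈1 / β⌉` steps. -/
lemma isOptimalTime_of_even {T₀ β : ℝ} {j L : ℕ} (hT₀ : 0 < T₀) (hπ : π = (j + (1 - β)) * T₀)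
    (hβ : 0 < β) (hβ1 : β < 1) (hj : Even j) (hj1 : 1 ≤ j) (hL : 1 ≤ L * β)
    (hL' : (L - 1) * β < 1) :
    IsOptimalTime (constantRate T₀) (j * T₀ + L * π) := by
  have hpi := Real.pi_pos
  have hL1 : (1 : ℝ) ≤ L := by
    have : 1 ≤ L := by
      rcases Nat.eq_zero_or_pos L with rfl | h
      · norm_num at hL
      · exact h
    exact_mod_cast this
  refine ⟨observableInTime_of_cover hT₀ (by positivity) fun s hs => ?_, fun T' hT' => ?_⟩
  · obtain ⟨n, y, rfl, hy0, hy1, hnj, hny⟩ := exists_floor_decomposition hT₀ hπ (by linarith) hs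
    classical
    have hex : ∃ r : ℕ, y < r * β := ⟨L, by linarith⟩
    obtain ⟨i, hi⟩ : ∃ i, Nat.find hex = i + 1 := by
      refine Nat.exists_eq_succ_of_ne_zero fun h0 => ?_
      have := Nat.find_spec hex
      rw [h0] at this
      norm_num at this
      linarith
    have hi1 : y < (i + 1) * β := by
      have := Nat.find_spec hex
      rw [hi] at this
      exact_mod_cast this
    have hi0 : i * β ≤ y := not_lt.1 (Nat.find_min hex (by omega))
    have hiL : i + 1 ≤ L := hi ▸ Nat.find_min' hex (by linarith)
    refine ⟨i, ?_, ?_⟩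
    · rcases hiL.eq_or_lt with h | h
      · have hLi : (L : ℝ) = i + 1 := by rw [← h]; push_cast; rfl
        rw [hLi] at hL ⊢
        have hn : n + 1 ≤ (j : ℤ) := by
          by_contra hcon
          have : (n : ℝ) = j := by exact_mod_cast (by omega : n = j)
          linarith
        have hn' : (n : ℝ) + 1 ≤ j := by exact_mod_cast hn
        gcongr
        linarith
      · have hLi : (i : ℝ) + 2 ≤ L := by exact_mod_cast h
        have h1 : (i + 2) * π ≤ L * π := by gcongr
        have h2 : 0 ≤ j * T₀ := by positivity
        linarith [hs.2]
    · rw [floor_div_eq (m := n + (i + 1) * (j + 1) - 1) (r := y - (i + 1) * β + 1) hT₀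
          (by rw [hπ]; push_cast; ring) (by linarith) (by linarith),
        floor_div_eq (m := n + i * (j + 1)) (r := y - i * β) hT₀ (by rw [hπ]; push_cast; ring)
          (by linarith) (by nlinarith [(i.cast_nonneg : (0 : ℝ) ≤ i)])]
      have : n + (i + 1) * (j + 1) - 1 - (n + i * (j + 1)) = ((j : ℕ) : ℤ) := by ring
      rw [this, Int.even_coe_nat]
      exact hj
  -- points just before `j T₀` wrap around after exactly `L` steps
  · have hj1' : (1 : ℝ) ≤ j := by exact_mod_cast hj1
    have hnn : 0 ≤ (L - 1) * β := mul_nonneg (by linarith) hβ.le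
    refine not_observableInTime (s₁ := max ((j - 1 + (L - 1) * β) * T₀) (T' - L * π))
      (s₂ := j * T₀) (m := j - 1) hT₀ (max_lt (by gcongr; linarith) (by linarith))
      (le_max_of_le_left (mul_nonneg (by linarith) hT₀.le)) ?_ ?_ ?_
    · rw [hπ]
      gcongr
      linarith
    all_goals
      intro s hs
      have hs1 := (le_max_left _ _).trans_lt hs.1
      have hs1' := (le_max_right _ _).trans_lt hs.1
      obtain ⟨y, rfl⟩ : ∃ y, s = (j - 1 + y) * T₀ := ⟨s / T₀ - (j - 1), by field_simp; ring⟩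
      have hy0 : (L - 1) * β < y := by
        have := lt_of_mul_lt_mul_right hs1 hT₀.le
        linarith
      have hy1 : y < 1 := by
        have := lt_of_mul_lt_mul_right hs.2 hT₀.le
        linarith
    · exact floor_div_eq (r := y) hT₀ (by push_cast; rfl) (by linarith) (by linarith)
    · intro i hi
      have hiL : i + 1 < L := by
        have : ((i + 1 : ℕ) : ℝ) * π < L * π := by push_cast; linarith
        exact_mod_cast lt_of_mul_lt_mul_right this hpi.le
      have hiL' : (i : ℝ) + 1 ≤ L - 1 := by
        have : ((i + 1 + 1 : ℕ) : ℝ) ≤ L := by exact_mod_cast hiL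
        push_cast at this
        linarith
      have h1 : (i + 1) * β ≤ (L - 1) * β := by gcongr
      have h0 : 0 ≤ i * β := by positivity
      rw [floor_div_eq (m := j - 1 + (i + 1) * (j + 1)) (r := y - (i + 1) * β) hT₀
          (by rw [hπ]; push_cast; ring) (by linarith) (by linarith),
        floor_div_eq (m := j - 1 + i * (j + 1)) (r := y - i * β) hT₀
          (by rw [hπ]; push_cast; ring) (by linarith) (by linarith)]
      have : (j : ℤ) - 1 + (i + 1) * (j + 1) - (j - 1 + i * (j + 1)) = ((j + 1 : ℕ) : ℤ) := by
        push_cast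
        ring
      rw [this]
      exact_mod_cast hj.add_one

lemma exists_nat_ceil_bounds {α : ℝ} (hα : 0 < α) : ∃ M : ℕ, 1 ≤ M * α ∧ (M - 1) * α < 1 := by
  refine ⟨⌈1 / α⌉₊, ?_, ?_⟩
  · rw [← div_le_iff₀ hα]
    exact Nat.le_ceil _
  · have := Nat.ceil_lt_add_one (one_div_pos.2 hα).le
    rw [← lt_div_iff₀ hα]
    linarith

end AlternatingWave

end

theorem lemma1p6 (T₀ : ℝ) (hT₀ : 0 < T₀) (hT₀π : T₀ < π) (hT₀N : ∀ m : ℕ, 2 * π / T₀ ≠ (m : ℝ))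
    (N j : ℕ) (hN : N = ⌊2 * π / T₀⌋₊) (hj : j = ⌊π / T₀⌋₊)
    (h k l q : ℕ)
    (hh : h = ⌈(π - j * T₀ + T₀) / (2 * π - N * T₀)⌉₊)
    (hk : k = ⌈T₀ / (2 * π - N * T₀)⌉₊)
    (hl : l = ⌈T₀ / ((N + 1) * T₀ - 2 * π)⌉₊)
    (hq : q = ⌈(π - j * T₀) / ((N + 1) * T₀ - 2 * π)⌉₊) :
    AlternatingWave.Observable (AlternatingWave.constantRate T₀) ∧
    (Even N → Even j →
      AlternatingWave.IsOptimalTime (AlternatingWave.constantRate T₀) (2 * π + j * T₀)) ∧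
    (Even N → Odd j →
      (h = k + 1 → AlternatingWave.IsOptimalTime (AlternatingWave.constantRate T₀)
        (π + T₀ * (N * k + 1))) ∧
      (h = k → AlternatingWave.IsOptimalTime (AlternatingWave.constantRate T₀)
        (π + T₀ * (N * k - j + 1)))) ∧
    (Odd N → Even j →
      (l = q → AlternatingWave.IsOptimalTime (AlternatingWave.constantRate T₀)
        (2 * π * q + j * T₀)) ∧
      (q + 1 = l → AlternatingWave.IsOptimalTime (AlternatingWave.constantRate T₀)
        (2 * π * q + j * T₀ + π))) ∧
    (Odd N → Odd j →
      AlternatingWave.IsOptimalTime (AlternatingWave.constantRate T₀) (N * T₀ + π)) := by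
  have hpi := Real.pi_pos
  obtain ⟨α, hπ⟩ : ∃ α, π = (j + α) * T₀ := ⟨π / T₀ - j, by field_simp; ring⟩
  have hdiv : π / T₀ = j + α := by rw [div_eq_iff hT₀.ne', hπ]
  have hdiv2 : 2 * π / T₀ = 2 * j + 2 * α := by rw [mul_div_assoc, hdiv]; ring
  obtain ⟨hα0, hα1⟩ : 0 ≤ α ∧ α < 1 := by
    have := (Nat.floor_eq_iff (div_pos hpi hT₀).le).1 hj.symm
    rw [hdiv] at this
    constructor <;> linarith [this.1, this.2]
  have hα : 0 < α := by
    refine lt_of_le_of_ne hα0 fun h0 => hT₀N (2 * j) ?_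
    rw [hdiv2, ← h0]
    push_cast
    ring
  have hα2 : α ≠ 1 / 2 := fun h0 => hT₀N (2 * j + 1) (by
    rw [hdiv2, h0]
    push_cast
    ring)
  have hj1 : 1 ≤ j := by
    rw [hj, Nat.one_le_floor_iff, one_le_div hT₀]
    exact hT₀π.le
  have hNfl := (Nat.floor_eq_iff (div_pos Real.two_pi_pos hT₀).le).1 hN.symm
  rw [hdiv2] at hNfl
  have hβ : π = (j + (1 - (1 - α))) * T₀ := by rw [sub_sub_cancel]; exact hπ
  -- the parity of `N` decides on which side of `1 / 2` the fractional part `α` lies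
  have hNeven : Even N → N = 2 * j ∧ α < 1 / 2 := by
    intro hev
    have h1 : N < 2 * j + 2 := by
      have : (N : ℝ) < ((2 * j + 2 : ℕ) : ℝ) := by push_cast; linarith
      exact_mod_cast this
    have h2 : 2 * j < N + 1 := by
      have : ((2 * j : ℕ) : ℝ) < ((N + 1 : ℕ) : ℝ) := by push_cast; linarith
      exact_mod_cast this
    have h3 : N = 2 * j := by
      obtain ⟨r, rfl⟩ := hev
      omega
    refine ⟨h3, ?_⟩
    have := hNfl.2
    rw [h3] at this
    push_cast at this
    linarith
  have hNodd : Odd N → N = 2 * j + 1 ∧ 1 / 2 < α := by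
    intro hodd
    have h1 : N < 2 * j + 2 := by
      have : (N : ℝ) < ((2 * j + 2 : ℕ) : ℝ) := by push_cast; linarith
      exact_mod_cast this
    have h2 : 2 * j < N + 1 := by
      have : ((2 * j : ℕ) : ℝ) < ((N + 1 : ℕ) : ℝ) := by push_cast; linarith
      exact_mod_cast this
    have h3 : N = 2 * j + 1 := by
      obtain ⟨r, rfl⟩ := hodd
      omega
    refine ⟨h3, lt_of_le_of_ne ?_ hα2.symm⟩
    have := hNfl.1
    rw [h3] at this
    push_cast at this
    linarith
  refine ⟨?_, fun hNe hje => ?_, fun hNe hjo => ?_, fun hNo hje => ?_, fun hNo hjo => ?_⟩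
  · rcases Nat.even_or_odd j with hje | hjo
    · obtain ⟨L, hL, hL'⟩ := AlternatingWave.exists_nat_ceil_bounds (sub_pos.2 hα1)
      exact ⟨_, (AlternatingWave.isOptimalTime_of_even hT₀ hβ (by linarith) (by linarith)
        hje hj1 hL hL').1⟩
    · obtain ⟨M, hM, hM'⟩ := AlternatingWave.exists_nat_ceil_bounds hα
      exact ⟨_, (AlternatingWave.isOptimalTime_of_odd hT₀ hπ hα hα1 hjo hM hM').1⟩
  · obtain ⟨-, hlt⟩ := hNeven hNe
    have := AlternatingWave.isOptimalTime_of_even (L := 2) hT₀ hβ (by linarith) (by linarith)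
      hje hj1 (by push_cast; linarith) (by push_cast; linarith)
    rwa [show (j : ℝ) * T₀ + ((2 : ℕ) : ℝ) * π = 2 * π + j * T₀ by push_cast; ring] at this
  · obtain ⟨hNj, hlt⟩ := hNeven hNe
    have hNj' : (N : ℝ) = 2 * j := by exact_mod_cast hNj
    have hden : 2 * π - N * T₀ = 2 * α * T₀ := by rw [hNj', hπ]; ring
    have eh : (π - j * T₀ + T₀) / (2 * π - N * T₀) = (1 + α) / (2 * α) := by
      rw [hden, show π - j * T₀ + T₀ = (1 + α) * T₀ by rw [hπ]; ring,
        mul_div_mul_right _ _ hT₀.ne']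
    have ek : T₀ / (2 * π - N * T₀) = 1 / (2 * α) := by
      rw [hden]
      field_simp
    rw [eh] at hh
    rw [ek] at hk
    have h2α : 0 < 2 * α := by linarith
    refine ⟨fun hhk => ?_, fun hhk => ?_⟩
    · have h1 : 1 / (2 * α) ≤ k := hk ▸ Nat.le_ceil _
      have h2 : (k : ℝ) < (1 + α) / (2 * α) := Nat.lt_ceil.1 (by omega)
      rw [div_le_iff₀ h2α] at h1
      rw [lt_div_iff₀ h2α] at h2
      have := AlternatingWave.isOptimalTime_of_odd (M := 2 * k) hT₀ hπ hα hα1 hjo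
        (by push_cast; linarith) (by push_cast; linarith)
      rwa [show (j : ℝ) * ((2 * k : ℕ) : ℝ) = N * k by rw [hNj']; push_cast; ring] at this
    · have hk1 : 1 ≤ k := by
        rw [hk, Nat.one_le_ceil_iff]
        positivity
      obtain ⟨p, rfl⟩ : ∃ p, k = p + 1 := ⟨k - 1, by omega⟩
      have h1 : (1 + α) / (2 * α) ≤ ((p + 1 : ℕ) : ℝ) := hhk ▸ hh ▸ Nat.le_ceil _
      have h2 : (p : ℝ) < 1 / (2 * α) := Nat.lt_ceil.1 (by omega)
      rw [div_le_iff₀ h2α] at h1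
      rw [lt_div_iff₀ h2α] at h2
      push_cast at h1
      have := AlternatingWave.isOptimalTime_of_odd (M := 2 * p + 1) hT₀ hπ hα hα1 hjo
        (by push_cast; linarith) (by push_cast; linarith)
      rwa [show (j : ℝ) * ((2 * p + 1 : ℕ) : ℝ) = N * ((p + 1 : ℕ) : ℝ) - j by
        rw [hNj']; push_cast; ring] at this
  · obtain ⟨hNj, hlt⟩ := hNodd hNo
    have hNj' : (N : ℝ) = 2 * j + 1 := by exact_mod_cast hNj
    have hden : (N + 1) * T₀ - 2 * π = 2 * (1 - α) * T₀ := by rw [hNj', hπ]; ring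
    have el : T₀ / ((N + 1) * T₀ - 2 * π) = 1 / (2 * (1 - α)) := by
      rw [hden]
      field_simp
    have eq : (π - j * T₀) / ((N + 1) * T₀ - 2 * π) = α / (2 * (1 - α)) := by
      rw [hden, show π - j * T₀ = α * T₀ by rw [hπ]; ring, mul_div_mul_right _ _ hT₀.ne']
    rw [el] at hl
    rw [eq] at hq
    have h2β : 0 < 2 * (1 - α) := by linarith
    refine ⟨fun hlq => ?_, fun hlq => ?_⟩
    · have hq1 : 1 ≤ q := by
        rw [hq, Nat.one_le_ceil_iff]
        positivity
      obtain ⟨p, rfl⟩ : ∃ p, q = p + 1 := ⟨q - 1, by omega⟩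
      have h1 : 1 / (2 * (1 - α)) ≤ ((p + 1 : ℕ) : ℝ) := hlq ▸ hl ▸ Nat.le_ceil _
      have h2 : (p : ℝ) < α / (2 * (1 - α)) := Nat.lt_ceil.1 (by omega)
      rw [div_le_iff₀ h2β] at h1
      rw [lt_div_iff₀ h2β] at h2
      push_cast at h1
      have := AlternatingWave.isOptimalTime_of_even (L := 2 * (p + 1)) hT₀ hβ (by linarith)
        (by linarith) hje hj1 (by push_cast; linarith) (by push_cast; linarith)
      rwa [show (j : ℝ) * T₀ + ((2 * (p + 1) : ℕ) : ℝ) * π = 2 * π * ((p + 1 : ℕ) : ℝ) + j * T₀ by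
        push_cast; ring] at this
    · have h1 : α / (2 * (1 - α)) ≤ q := hq ▸ Nat.le_ceil _
      have h2 : (q : ℝ) < 1 / (2 * (1 - α)) := Nat.lt_ceil.1 (by omega)
      rw [div_le_iff₀ h2β] at h1
      rw [lt_div_iff₀ h2β] at h2
      have := AlternatingWave.isOptimalTime_of_even (L := 2 * q + 1) hT₀ hβ (by linarith)
        (by linarith) hje hj1 (by push_cast; linarith) (by push_cast; linarith)
      rwa [show (j : ℝ) * T₀ + ((2 * q + 1 : ℕ) : ℝ) * π = 2 * π * q + j * T₀ + π by
        push_cast; ring] at this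
  · obtain ⟨hNj, hlt⟩ := hNodd hNo
    have hNj' : (N : ℝ) = 2 * j + 1 := by exact_mod_cast hNj
    have := AlternatingWave.isOptimalTime_of_odd (M := 2) hT₀ hπ hα hα1 hjo
      (by push_cast; linarith) (by push_cast; linarith)
    rwa [show π + T₀ * ((j : ℝ) * ((2 : ℕ) : ℝ) + 1) = N * T₀ + π by
      rw [hNj']; push_cast; ring] at this
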